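/- **Conventions.** A metric space is $\delta$-hyperbolic if it is geodesic and $(x,z)_w\ge\min\{(x,y)_w,(y,z)_w\}-\delta$ for all $w,x,y,z$, where $(a,b)_c=\frac12[d(a,c)+d(b,c)-d(a,b)]$; it is hyperbolic if it is $\delta$-hyperbolic for some $\delta$. Its Gromov boundary $\partial X$ is the set of geodesic rays $r:[0,\infty)\to X$ from a fixed base point $x_0$, modulo $r_1\sim r_2$ iff $\sup_t d(r_1(t),r_2(t))<\infty$. The space $\widehat X=X\cup\partial X$ carries the usual topology: a set $U$ is open iff $U\cap X$ is open in $X$ and for every ray $r$ with $[r]\in U$ there is $n$ such that $U$ contains all $x\in X$ with $(x,r(t))_{x_0}\ge n$ for all large $t$, and all $[s]\in\partial X$ with $(s(t),r(t))_{x_0}\ge n$ for all large $t$. The induced path metric on a subset $S\subseteq X$ is the infimum of the lengths, measured in $X$, of the paths in $S$ joining two given points. Let $T=[0,\infty)$ or $T=\mathbb R$, with the integers in $T$ as vertices and the intervals $[j,j+1]\subseteq T$, $j$ a vertex, as edges. A tree ($T$) of hyperbolic metric spaces satisfying the qi-embedded condition is a metric space $(X,d)$ with a continuous map $P$ from $X$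 onto $T$ such that there are $\delta,\epsilon$ and $K>0$ with the following properties. 1. For every vertex $j$ the vertex space $Y_j=P^{-1}(j)$ with its induced path metric $d_j$ is a $\delta$-hyperbolic metric space, and the inclusions $Y_j\to X$ are uniformly proper: for all $M>0$ there is $N>0$ such that for all $j$ and $x,y\in Y_j$, $d(x,y)\le M$ implies $d_j(x,y)\le N$. 2. For every edge $e=[j,j+1]$ the edge space $X_e=P^{-1}(j+\frac12)$ with its induced path metric $d_e$ is a $\delta$-hyperbolic metric space. 3. For every edge $e=[j,j+1]$ there is a continuous map $f_e:X_e\times[0,1]\to X$ with $P(f_e(x,t))=j+t$ whose restriction to $X_e\times(0,1)$, with the metric $\sqrt{d_e(x,y)^2+|s-t|^2}$, is an isometry onto $P^{-1}((j,j+1))$ with its induced path metric. 4. $f_e(\cdot,0):X_e\to Y_j$ and $f_e(\cdot,1):X_e\to Y_{j+1}$ are $(K,\epsilon)$-quasi-isometric embeddings, i.e. $\frac1K d_e(x,y)-\epsilon\le d_j(f_e(x,0),f_e(y,0))\le K d_e(x,y)+\epsilon$, and likewise for $f_e(\cdot,1)$ and $d_{j+1}$. **Theorem.** Let $X$ be such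 a tree of hyperbolic metric spaces, where $T=[0,\infty)$ or $T=\mathbb R$, and suppose that $X$ is proper (closed balls are compact). If $X$ is hyperbolic, then a Cannon–Thurston map exists for the inclusion $i:Y_0\to X$: for all base points $y_0\in Y_0$ and $x_0\in X$, the map $i$ extends to a continuous map $\hat i:\widehat{Y_0}\to\widehat X$ of the Gromov compactifications, where $Y_0$ carries the metric $d_0$. -/

import Mathlib

open scoped NNReal ENNReal

noncomputable section

/-! ### Gromov hyperbolic spaces -/

/-- The Gromov inner product `(a, b)_c = ½ (d(a, c) + d(b, c) - d(a, b))`. -/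
def gromovProduct {X : Type*} [MetricSpace X] (c a b : X) : ℝ :=
  (dist a c + dist b c - dist a b) / 2

/-- Every two points are joined by a geodesic segment. -/
def IsGeodesicMetricSpace (X : Type*) [MetricSpace X] : Prop :=
  ∀ x y : X, ∃ γ : ℝ → X, γ 0 = x ∧ γ (dist x y) = y ∧
    ∀ s ∈ Set.Icc 0 (dist x y), ∀ t ∈ Set.Icc 0 (dist x y), dist (γ s) (γ t) = |s - t|

/-- A `δ`-hyperbolic metric space in the sense of Gromov: a geodesic metric space in which
`(x, z)_w ≥ min ((x, y)_w) ((y, z)_w) - δ` for all `w, x, y, z`. -/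
structure IsDeltaHyperbolic (δ : ℝ) (X : Type*) [MetricSpace X] : Prop where
  geodesic : IsGeodesicMetricSpace X
  four_point : ∀ w x y z : X,
    min (gromovProduct w x y) (gromovProduct w y z) - δ ≤ gromovProduct w x z

/-- A hyperbolic metric space. -/
def IsHyperbolic (X : Type*) [MetricSpace X] : Prop := ∃ δ : ℝ, IsDeltaHyperbolic δ X

/-- `(K, ε)`-quasi-isometric embeddings. -/
def IsQIEmbedding {Y Z : Type*} [MetricSpace Y] [MetricSpace Z] (K ε : ℝ) (f : Y → Z) : Prop :=
  ∀ y₁ y₂ : Y, 1 / K * dist y₁ y₂ - ε ≤ dist (f y₁) (f y₂) ∧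
    dist (f y₁) (f y₂) ≤ K * dist y₁ y₂ + ε

/-! ### The Gromov boundary and the Gromov compactification -/

/-- Geodesic rays `[0, ∞) → X` starting at `x₀`. -/
def GeodesicRay (X : Type*) [MetricSpace X] (x₀ : X) : Type _ :=
  {r : ℝ≥0 → X // Isometry r ∧ r 0 = x₀}

/-- Two rays are equivalent if `sup_t d(r₁(t), r₂(t)) < ∞`. -/
instance GeodesicRay.setoid (X : Type*) [MetricSpace X] (x₀ : X) : Setoid (GeodesicRay X x₀) where
  r r₁ r₂ := ∃ C : ℝ, ∀ t, dist (r₁.1 t) (r₂.1 t) ≤ C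
  iseqv :=
    { refl := fun r => ⟨0, fun t => by simp⟩
      symm := fun {_ _} ⟨C, h⟩ => ⟨C, fun t => by rw [dist_comm]; exact h t⟩
      trans := fun {_ _ _} ⟨C, h⟩ ⟨D, k⟩ =>
        ⟨C + D, fun t => (dist_triangle _ _ _).trans (add_le_add (h t) (k t))⟩ }

/-- The Gromov boundary `∂X`: equivalence classes of geodesic rays from the base point. -/
def GromovBoundary (X : Type*) [MetricSpace X] (x₀ : X) : Type _ :=
  Quotient (GeodesicRay.setoid X x₀)

/-- The boundary point represented by a geodesic ray. -/
def GeodesicRay.endpoint {X : Type*} [MetricSpace X] {x₀ : X} (r : GeodesicRay X x₀) :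
    GromovBoundary X x₀ :=
  Quotient.mk (GeodesicRay.setoid X x₀) r

/-- The underlying set of the Gromov compactification `X ∪ ∂X`. -/
inductive GromovCompactification (X : Type*) [MetricSpace X] (x₀ : X) : Type _
  | point (x : X) : GromovCompactification X x₀
  | bdry (ξ : GromovBoundary X x₀) : GromovCompactification X x₀

namespace GromovCompactification

variable {X : Type*} [MetricSpace X] {x₀ : X}

/-- The basic neighbourhood, of size `n`, of the endpoint of the ray `r`: the points `x` of `X`
whose Gromov product with `r(t)` based at `x₀` is at least `n` for all large `t`, and the endpoints
of the rays `s` such that the Gromov product of `s(t)` and `r(t)` is at least `n` for all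
large `t`. -/
def basicNhd (r : GeodesicRay X x₀) (n : ℝ) : Set (GromovCompactification X x₀) :=
  {z | (∃ x : X, z = point x ∧ ∀ᶠ t in Filter.atTop, n ≤ gromovProduct x₀ x (r.1 t)) ∨
    ∃ s : GeodesicRay X x₀, z = bdry s.endpoint ∧
      ∀ᶠ t in Filter.atTop, n ≤ gromovProduct x₀ (s.1 t) (r.1 t)}

theorem basicNhd_anti (r : GeodesicRay X x₀) {m n : ℝ} (h : m ≤ n) :
    basicNhd r n ⊆ basicNhd r m := by
  rintro z (⟨x, hz, hx⟩ | ⟨s, hz, hs⟩)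
  · exact Or.inl ⟨x, hz, hx.mono fun t ht => h.trans ht⟩
  · exact Or.inr ⟨s, hz, hs.mono fun t ht => h.trans ht⟩

/-- The usual topology of `X ∪ ∂X`: a set is open if its trace on `X` is open and it contains a
basic neighbourhood of each of its boundary points. -/
instance : TopologicalSpace (GromovCompactification X x₀) where
  IsOpen U := IsOpen (point ⁻¹' U : Set X) ∧
    ∀ r : GeodesicRay X x₀, bdry r.endpoint ∈ U → ∃ n : ℝ, basicNhd r n ⊆ U
  isOpen_univ := ⟨isOpen_univ, fun _ _ => ⟨0, Set.subset_univ _⟩⟩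
  isOpen_inter := by
    rintro U V ⟨hU, hU'⟩ ⟨hV, hV'⟩
    refine ⟨hU.inter hV, fun r hr => ?_⟩
    obtain ⟨m, hm⟩ := hU' r hr.1
    obtain ⟨n, hn⟩ := hV' r hr.2
    exact ⟨max m n, Set.subset_inter ((basicNhd_anti r (le_max_left m n)).trans hm)
      ((basicNhd_anti r (le_max_right m n)).trans hn)⟩
  isOpen_sUnion := by
    intro 𝒰 h𝒰
    refine ⟨?_, ?_⟩
    · rw [Set.preimage_sUnion]
      exact isOpen_biUnion fun U hU => (h𝒰 U hU).1
    · rintro r ⟨U, hU, hr⟩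
      obtain ⟨n, hn⟩ := (h𝒰 U hU).2 r hr
      exact ⟨n, hn.trans (Set.subset_sUnion_of_mem hU)⟩

end GromovCompactification

/-- The map `i : Y → X` has a Cannon–Thurston map: it extends to a continuous map between the
Gromov compactifications (formed with base points `y₀` and `x₀`). -/
def HasCannonThurstonMap {Y X : Type*} [MetricSpace Y] [MetricSpace X] (i : Y → X)
    (y₀ : Y) (x₀ : X) : Prop :=
  ∃ î : GromovCompactification Y y₀ → GromovCompactification X x₀,
    Continuous î ∧ ∀ y : Y, î (.point y) = .point (i y)

/-! ### Induced path metrics -/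

section InducedPath

variable {X : Type*} [MetricSpace X]

/-- `γ`, restricted to `[0, 1]`, is a continuous path from `x` to `y` inside `S`. -/
structure IsPathIn (S : Set X) (x y : X) (γ : ℝ → X) : Prop where
  continuousOn : ContinuousOn γ (Set.Icc 0 1)
  mapsTo : Set.MapsTo γ (Set.Icc 0 1) S
  source : γ 0 = x
  target : γ 1 = y

/-- The path distance in `S ⊆ X`: the infimum of the lengths of the paths in `S` from `x` to `y`,
with value `∞` if there is no rectifiable one. -/
def pathEDist (S : Set X) (x y : X) : ℝ≥0∞ :=
  ⨅ (γ : ℝ → X) (_ : IsPathIn S x y γ), eVariationOn γ (Set.Icc 0 1)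

theorem edist_le_pathEDist (S : Set X) (x y : X) : edist x y ≤ pathEDist S x y := by
  refine le_iInf₂ fun γ h => ?_
  rw [← h.source, ← h.target]
  exact eVariationOn.edist_le γ (by simp) (by simp)

theorem pathEDist_self {S : Set X} {x : X} (hx : x ∈ S) : pathEDist S x x = 0 := by
  refine le_antisymm ?_ bot_le
  refine (iInf₂_le (fun _ => x) ⟨continuousOn_const, fun _ _ => hx, rfl, rfl⟩).trans ?_
  exact (eVariationOn.constant_on (by rintro _ ⟨_, _, rfl⟩ _ ⟨_, _, rfl⟩; rfl)).le

theorem pathEDist_comm_le (S : Set X) (x y : X) : pathEDist S y x ≤ pathEDist S x y := by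
  refine le_iInf₂ fun γ h => ?_
  have hm : Set.MapsTo (fun t : ℝ => 1 - t) (Set.Icc 0 1) (Set.Icc 0 1) := by
    rintro t ⟨h0, h1⟩; constructor <;> dsimp <;> linarith
  refine (iInf₂_le (γ ∘ fun t => 1 - t) ⟨h.continuousOn.comp (by fun_prop) hm, h.mapsTo.comp hm,
    by simp [h.target], by simp [h.source]⟩).trans ?_
  exact eVariationOn.comp_le_of_antitoneOn γ _ (fun a _ b _ hab => by linarith) hm

theorem pathEDist_triangle (S : Set X) (x y z : X) :
    pathEDist S x z ≤ pathEDist S x y + pathEDist S y z := by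
  unfold pathEDist
  simp only [ENNReal.iInf_add, ENNReal.add_iInf]
  refine le_iInf₂ fun γ' h' => le_iInf₂ fun γ h => ?_
  set g : ℝ → X := fun t => if t ≤ 1 / 2 then γ (2 * t) else γ' (2 * t - 1) with hg
  have e1 : Set.EqOn g (γ ∘ fun t => 2 * t) (Set.Icc 0 (1 / 2)) := by
    intro t ht; simp only [hg, Function.comp]; rw [if_pos ht.2]
  have e2 : Set.EqOn g (γ' ∘ fun t => 2 * t - 1) (Set.Icc (1 / 2) 1) := by
    intro t ht
    rcases eq_or_lt_of_le ht.1 with rfl | h2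
    · simp [hg, h.target, h'.source]
    · simp only [hg, Function.comp]; rw [if_neg (not_le.2 h2)]
  have m1 : Set.MapsTo (fun t : ℝ => 2 * t) (Set.Icc 0 (1 / 2)) (Set.Icc 0 1) := by
    rintro t ⟨h0, h1⟩; constructor <;> dsimp <;> linarith
  have m2 : Set.MapsTo (fun t : ℝ => 2 * t - 1) (Set.Icc (1 / 2) 1) (Set.Icc 0 1) := by
    rintro t ⟨h0, h1⟩; constructor <;> dsimp <;> linarith
  have hU : Set.Icc (0 : ℝ) 1 = Set.Icc 0 (1 / 2) ∪ Set.Icc (1 / 2) 1 :=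
    (Set.Icc_union_Icc_eq_Icc (by norm_num) (by norm_num)).symm
  have hp : IsPathIn S x z g := by
    refine ⟨?_, ?_, by simp [hg, h.source], by norm_num [hg, h'.target]⟩
    · rw [hU]
      exact ((h.continuousOn.comp (by fun_prop) m1).congr e1).union_of_isClosed
        ((h'.continuousOn.comp (by fun_prop) m2).congr e2) isClosed_Icc isClosed_Icc
    · rw [hU]
      rintro t (ht | ht)
      · rw [e1 ht]; exact h.mapsTo (m1 ht)
      · rw [e2 ht]; exact h'.mapsTo (m2 ht)
  refine (iInf₂_le g hp).trans ?_
  have hadd := eVariationOn.Icc_add_Icc g (s := Set.univ) (a := 0) (b := 1 / 2) (c := 1)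
    (by norm_num) (by norm_num) (Set.mem_univ _)
  simp only [Set.univ_inter] at hadd
  rw [← hadd, eVariationOn.eq_of_eqOn e1, eVariationOn.eq_of_eqOn e2]
  exact add_le_add
    (eVariationOn.comp_le_of_monotoneOn γ _ (fun a _ b _ hab => by linarith) m1)
    (eVariationOn.comp_le_of_monotoneOn γ' _ (fun a _ b _ hab => by linarith) m2)

/-- The path distance in `S` is finite, so that it is a metric. -/
class RectifiablyConnected (S : Set X) : Prop where
  ne_top : ∀ x ∈ S, ∀ y ∈ S, pathEDist S x y ≠ ∞

/-- The subset `S` of `X`, to be equipped with the induced path metric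
(and not with the restriction of the metric of `X`). -/
@[ext]
structure PathSpace (S : Set X) where
  /-- the point of `X` -/
  val : X
  mem : val ∈ S

/-- The induced path metric. -/
instance (S : Set X) [RectifiablyConnected S] : MetricSpace (PathSpace S) where
  dist x y := (pathEDist S x.val y.val).toReal
  dist_self x := by simp [pathEDist_self x.mem]
  dist_comm x y := by
    rw [le_antisymm (pathEDist_comm_le S x.val y.val) (pathEDist_comm_le S y.val x.val)]
  dist_triangle x y z := by
    have h₁ := RectifiablyConnected.ne_top (S := S) _ x.mem _ y.mem
    have h₂ := RectifiablyConnected.ne_top (S := S) _ y.mem _ z.mem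
    rw [← ENNReal.toReal_add h₁ h₂]
    exact ENNReal.toReal_mono (ENNReal.add_ne_top.2 ⟨h₁, h₂⟩) (pathEDist_triangle S _ _ _)
  eq_of_dist_eq_zero {x y} h := by
    have h₀ : pathEDist S x.val y.val = 0 :=
      ((ENNReal.toReal_eq_zero_iff _).1 h).resolve_right
        (RectifiablyConnected.ne_top (S := S) _ x.mem _ y.mem)
    exact PathSpace.ext (edist_le_zero.1 (h₀ ▸ edist_le_pathEDist S x.val y.val))

end InducedPath

/-! ### Trees of hyperbolic metric spaces over a ray or a line -/

/-- The two trees under consideration. -/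
inductive LinearTree
  | ray
  | line

namespace LinearTree

/-- The tree as a metric space: `[0, ∞)` or `ℝ`. -/
def carrier : LinearTree → Set ℝ
  | ray => Set.Ici 0
  | line => Set.univ

/-- The vertices are the integer points of the tree. The edges are the intervals `[j, j + 1]` with
`j` a vertex; the edge `[j, j + 1]` is denoted by its initial vertex `j`. -/
def Vertex (T : LinearTree) : Type := {j : ℤ // (j : ℝ) ∈ T.carrier}

/-- The point of the real line at which a vertex lies. -/
def Vertex.pos {T : LinearTree} (j : T.Vertex) : ℝ := (j.1 : ℝ)

/-- The vertex `0`. -/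
def root : (T : LinearTree) → T.Vertex
  | ray => ⟨0, by simp [carrier]⟩
  | line => ⟨0, by simp [carrier]⟩

/-- The terminal vertex `j + 1` of the edge `[j, j + 1]`. -/
def Vertex.succ : {T : LinearTree} → T.Vertex → T.Vertex
  | ray, j => ⟨j.1 + 1, by
      have h : (0 : ℝ) ≤ (j.1 : ℝ) := j.2
      simp only [carrier, Set.mem_Ici, Int.cast_add, Int.cast_one]; linarith⟩
  | line, j => ⟨j.1 + 1, by simp [carrier]⟩

theorem Vertex.pos_succ {T : LinearTree} (j : T.Vertex) : j.succ.pos = j.pos + 1 := by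
  cases T <;> simp [Vertex.succ, Vertex.pos]

end LinearTree

/-- The structure of a tree of hyperbolic metric spaces with the quasi-isometrically embedded
condition on a metric space `X`, for the tree `T = [0, ∞)` or `T = ℝ`. The vertex space over `v` is
the fibre `P⁻¹(v)`, and the edge space of the edge `e = [j, j + 1]` is the fibre over its
mid-point, each with the induced path metric. -/
structure TreeOfHyperbolicSpaces (X : Type*) [MetricSpace X] (T : LinearTree) where
  /-- the projection of `X` onto the tree -/
  P : X → ℝ
  continuous_P : Continuous P
  range_P : Set.range P = T.carrier
  /-- the uniform constants -/
  (δ ε K : ℝ)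
  K_pos : 0 < K
  [vertex_rectifiable : ∀ v : T.Vertex, RectifiablyConnected (P ⁻¹' {v.pos})]
  vertex_hyperbolic : ∀ v : T.Vertex, IsDeltaHyperbolic δ (PathSpace (P ⁻¹' {v.pos}))
  uniformly_proper : ∀ M : ℝ, 0 < M → ∃ N : ℝ, 0 < N ∧
    ∀ (v : T.Vertex) (x y : PathSpace (P ⁻¹' {v.pos})), dist x.val y.val ≤ M → dist x y ≤ N
  [edge_rectifiable : ∀ e : T.Vertex, RectifiablyConnected (P ⁻¹' {e.pos + 1 / 2})]
  edge_hyperbolic : ∀ e : T.Vertex, IsDeltaHyperbolic δ (PathSpace (P ⁻¹' {e.pos + 1 / 2}))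
  /-- the maps `f_e : X_e × [0, 1] → X` -/
  f : ∀ e : T.Vertex, PathSpace (P ⁻¹' {e.pos + 1 / 2}) × unitInterval → X
  continuous_f : ∀ e, Continuous (f e)
  /-- `f_e` maps `X_e × {t}` into the fibre over the point of `e` with parameter `t` -/
  P_f : ∀ e x (t : unitInterval), P (f e (x, t)) = e.pos + t
  /-- `f_e` maps `X_e × (0, 1)` onto the preimage of the interior of `e` … -/
  f_surjOn : ∀ e, Set.SurjOn (f e) (Set.univ ×ˢ Set.Ioo 0 1) (P ⁻¹' Set.Ioo e.pos (e.pos + 1))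
  /-- … isometrically for the product metric and the path metric of this preimage -/
  f_isometry : ∀ e x y, ∀ s ∈ Set.Ioo (0 : unitInterval) 1, ∀ t ∈ Set.Ioo (0 : unitInterval) 1,
    pathEDist (P ⁻¹' Set.Ioo e.pos (e.pos + 1)) (f e (x, s)) (f e (y, t)) =
      ENNReal.ofReal (Real.sqrt (dist x y ^ 2 + dist s t ^ 2))
  qi_initial : ∀ e : T.Vertex, IsQIEmbedding K ε
    (fun x => (⟨f e (x, 0), by simp [P_f]⟩ : PathSpace (P ⁻¹' {e.pos})))
  qi_terminal : ∀ e : T.Vertex, IsQIEmbedding K ε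
    (fun x => (⟨f e (x, 1), by simp [P_f, e.pos_succ]⟩ : PathSpace (P ⁻¹' {e.succ.pos})))

namespace TreeOfHyperbolicSpaces

variable {X : Type*} [MetricSpace X] {T : LinearTree}

attribute [instance] vertex_rectifiable edge_rectifiable

/-- The vertex space `Y_v = P⁻¹(v)` with the induced path metric. -/
abbrev VertexSpace (S : TreeOfHyperbolicSpaces X T) (v : T.Vertex) : Type _ :=
  PathSpace (S.P ⁻¹' {v.pos})

/-- The inclusion `Y_v → X`. -/
def inclusion (S : TreeOfHyperbolicSpaces X T) (v : T.Vertex) : S.VertexSpace v → X :=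
  PathSpace.val

end TreeOfHyperbolicSpaces

end

/-!
The map `Y₀ → X` extends to the boundaries as soon as large Gromov products in `Y₀` have large
Gromov products in `X` as images (`hasCannonThurstonMap_of_gromovProduct`): the image of a ray of
`Y₀` then converges to the endpoint of a ray of `X`, which exists because `X` is proper, and the
same estimate gives continuity. So it has to be shown that a geodesic of `X` between `a, b ∈ Y₀` is
far from the base point when a geodesic `λ` of `Y₀` between them is far from it
(`exists_gromovProduct_bound`).

To this end a ladder is built over `λ`, following Mitra: a geodesic `λₙ` in each vertex space `Yₙ`,
where `λₙ₊₁` joins the points that are obtained from the endpoints of `λₙ` by projecting them to the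
image of the edge space in `Yₙ` and transporting them to `Yₙ₊₁`. If `λₙ` is far from this image, the
ladder stops. The union `B` of the `λₙ` is a coarse Lipschitz retract of `X`: on `Yₙ` the retraction
is the projection to `λₙ`, and beyond the last step it is constant. For `λₙ = [aₙ, bₙ]` the
projection is `z ↦ λₙ((z, bₙ)_{aₙ})`, which never increases distances and whose value is a coarse
centre of the triangle `z, aₙ, bₙ`. Since quasi-isometric embeddings preserve coarse centres and
these are coarsely unique, the projections are compatible with the edges (`exists_ladder_step`).
Uniform properness of the vertex spaces turns this into a coarse Lipschitz map of `X`
(`exists_coarse_extension`).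

A coarse Lipschitz retract of a hyperbolic space is quasi-convex
(`exists_dist_le_of_isChainConvex`), so that the geodesics of `X` from `a` to `b` stay near `B`.
Finally `B` is far from the base point: a point of `λₙ` is at distance at least about `n / 4` from
`Y₀`, and at distance at most `C n` from a point of `λ`, which is far from the base point in `Y₀`,
hence also in `X`, by uniform properness.
-/

namespace CannonThurston

/-! ### Gromov products and coarse centres of triangles -/

section Calculus

variable {X : Type*} [MetricSpace X]

/-- `γ`, restricted to `[0, d(x, y)]`, is a geodesic segment from `x` to `y`. -/
structure IsGeodesicSegment (γ : ℝ → X) (x y : X) : Prop where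
  source : γ 0 = x
  target : γ (dist x y) = y
  dist_eq : ∀ s ∈ Set.Icc 0 (dist x y), ∀ t ∈ Set.Icc 0 (dist x y), dist (γ s) (γ t) = |s - t|

theorem exists_isGeodesicSegment (h : IsGeodesicMetricSpace X) (x y : X) :
    ∃ γ, IsGeodesicSegment γ x y := by
  obtain ⟨γ, h1, h2, h3⟩ := h x y
  exact ⟨γ, h1, h2, h3⟩

theorem gromovProduct_comm (c a b : X) : gromovProduct c a b = gromovProduct c b a := by
  simp only [gromovProduct, dist_comm a b]; ring

theorem gromovProduct_nonneg (c a b : X) : 0 ≤ gromovProduct c a b := by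
  have := dist_triangle_right a b c
  simp only [gromovProduct]; linarith

theorem gromovProduct_le_dist (c a b : X) : gromovProduct c a b ≤ dist c b := by
  have := dist_triangle a b c
  simp only [gromovProduct, dist_comm c b]; linarith

theorem gromovProduct_mem_Icc (c a b : X) : gromovProduct c a b ∈ Set.Icc 0 (dist c b) :=
  ⟨gromovProduct_nonneg c a b, gromovProduct_le_dist c a b⟩

theorem gromovProduct_self (c a : X) : gromovProduct c a a = dist a c := by
  simp [gromovProduct]

theorem dist_sub_dist_le_gromovProduct (c a b : X) :
    dist a c - dist a b ≤ gromovProduct c a b := by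
  have := dist_triangle a b c
  simp only [gromovProduct]; linarith

theorem gromovProduct_le_add_left (c a a' b : X) :
    gromovProduct c a b ≤ gromovProduct c a' b + dist a a' := by
  have := dist_triangle a a' c
  have := dist_triangle_left a' b a
  simp only [gromovProduct]; linarith

theorem gromovProduct_le_add_right (c a b b' : X) :
    gromovProduct c a b ≤ gromovProduct c a b' + dist b b' := by
  have := dist_triangle b b' c
  have := dist_triangle a b b'
  simp only [gromovProduct]; linarith

theorem gromovProduct_le_add_base (c c' a b : X) :
    gromovProduct c a b ≤ gromovProduct c' a b + dist c c' := by
  have := dist_triangle a c' c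
  have := dist_triangle b c' c
  rw [dist_comm c' c] at *
  simp only [gromovProduct]; linarith

namespace IsGeodesicSegment

variable {γ : ℝ → X} {a b : X}

theorem dist_source (h : IsGeodesicSegment γ a b) {t : ℝ} (ht : t ∈ Set.Icc 0 (dist a b)) :
    dist a (γ t) = t := by
  have := h.dist_eq 0 ⟨le_rfl, dist_nonneg⟩ t ht
  rw [h.source, zero_sub, abs_neg, abs_of_nonneg ht.1] at this
  exact this

theorem dist_target (h : IsGeodesicSegment γ a b) {t : ℝ} (ht : t ∈ Set.Icc 0 (dist a b)) :
    dist (γ t) b = dist a b - t := by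
  have := h.dist_eq t ht (dist a b) ⟨dist_nonneg, le_rfl⟩
  rw [h.target, abs_sub_comm, abs_of_nonneg (sub_nonneg.2 ht.2)] at this
  exact this

theorem gromovProduct_eq_zero (h : IsGeodesicSegment γ a b) {t : ℝ}
    (ht : t ∈ Set.Icc 0 (dist a b)) : gromovProduct (γ t) a b = 0 := by
  have h1 := h.dist_source ht
  have h2 := h.dist_target ht
  rw [dist_comm] at h2
  simp only [gromovProduct]; linarith

theorem gromovProduct_apply (h : IsGeodesicSegment γ a b) {t : ℝ}
    (ht : t ∈ Set.Icc 0 (dist a b)) : gromovProduct a (γ t) b = t := by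
  have h1 := h.dist_source ht
  have h2 := h.dist_target ht
  simp only [gromovProduct, dist_comm b, dist_comm (γ t) a]; linarith

theorem continuousOn (h : IsGeodesicSegment γ a b) : ContinuousOn γ (Set.Icc 0 (dist a b)) := by
  refine (LipschitzOnWith.of_dist_le_mul (K := 1) fun s hs t ht => ?_).continuousOn
  rw [h.dist_eq s hs t ht, Real.dist_eq]; simp

theorem symm (h : IsGeodesicSegment γ a b) :
    IsGeodesicSegment (fun t => γ (dist a b - t)) b a := by
  refine ⟨by simp [h.target], by simp [dist_comm b a, h.source], fun s hs t ht => ?_⟩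
  rw [dist_comm b a] at hs ht
  rw [h.dist_eq _ ⟨by linarith [hs.2], by linarith [hs.1]⟩ _
    ⟨by linarith [ht.2], by linarith [ht.1]⟩, abs_sub_comm]
  congr 1; ring

theorem subsegment (h : IsGeodesicSegment γ a b) {s t : ℝ} (hs : 0 ≤ s) (hst : s ≤ t)
    (ht : t ≤ dist a b) : IsGeodesicSegment (fun r => γ (s + r)) (γ s) (γ t) := by
  have hd : dist (γ s) (γ t) = t - s := by
    rw [h.dist_eq s ⟨hs, hst.trans ht⟩ t ⟨hs.trans hst, ht⟩, abs_sub_comm,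
      abs_of_nonneg (sub_nonneg.2 hst)]
  refine ⟨by simp, by simp [hd], fun u hu v hv => ?_⟩
  rw [hd] at hu hv
  rw [h.dist_eq _ ⟨by linarith [hu.1], by linarith [hu.2]⟩ _
    ⟨by linarith [hv.1], by linarith [hv.2]⟩]
  congr 1; ring

/-- The map `z ↦ γ((z, b)_a)` is a retraction onto the segment `γ` from `a` to `b` that does not
increase distances, whatever the geometry of the space. -/
theorem dist_projection_le (h : IsGeodesicSegment γ a b) (y z : X) :
    dist (γ (gromovProduct a y b)) (γ (gromovProduct a z b)) ≤ dist y z := by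
  rw [h.dist_eq _ (gromovProduct_mem_Icc a y b) _ (gromovProduct_mem_Icc a z b), abs_le]
  have h1 := gromovProduct_le_add_left a y z b
  have h2 := gromovProduct_le_add_left a z y b
  rw [dist_comm z y] at h2
  constructor <;> linarith

theorem gromovProduct_le_dist_apply (h : IsGeodesicSegment γ a b) {t : ℝ}
    (ht : t ∈ Set.Icc 0 (dist a b)) (w : X) : gromovProduct w a b ≤ dist w (γ t) := by
  have := gromovProduct_le_add_base w (γ t) a b
  rw [h.gromovProduct_eq_zero ht] at this
  linarith

end IsGeodesicSegment

/-- `p` is a coarse centre of the triangle `x, y, z`: it lies near all three sides. -/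
structure IsCoarseCenter (C : ℝ) (p x y z : X) : Prop where
  left : gromovProduct p x y ≤ C
  middle : gromovProduct p y z ≤ C
  right : gromovProduct p x z ≤ C

theorem IsCoarseCenter.mono {C D : ℝ} {p x y z : X} (h : IsCoarseCenter C p x y z) (hCD : C ≤ D) :
    IsCoarseCenter D p x y z :=
  ⟨h.left.trans hCD, h.middle.trans hCD, h.right.trans hCD⟩

end Calculus

end CannonThurston

namespace IsDeltaHyperbolic

open CannonThurston

variable {X : Type*} [MetricSpace X] {δ : ℝ}

theorem delta_nonneg (h : IsDeltaHyperbolic δ X) (x : X) : 0 ≤ δ := by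
  have := h.four_point x x x x
  simp [gromovProduct] at this
  exact this

theorem dist_add_dist_le (h : IsDeltaHyperbolic δ X) (x y z w : X) :
    dist x z + dist y w ≤ max (dist x y + dist z w) (dist y z + dist x w) + 2 * δ := by
  have := h.four_point w x y z
  rcases min_cases (gromovProduct w x y) (gromovProduct w y z) with ⟨h1, _⟩ | ⟨h1, _⟩
  · rw [h1] at this
    have := le_max_left (dist x y + dist z w) (dist y z + dist x w)
    simp only [gromovProduct] at *; linarith
  · rw [h1] at this
    have := le_max_right (dist x y + dist z w) (dist y z + dist x w)
    simp only [gromovProduct] at *; linarith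

theorem dist_projection_le (h : IsDeltaHyperbolic δ X) {γ : ℝ → X} {a b : X}
    (hγ : IsGeodesicSegment γ a b) (z : X) :
    dist z (γ (gromovProduct a z b)) ≤ gromovProduct z a b + 2 * δ := by
  have ht := gromovProduct_mem_Icc a z b
  have h1 := hγ.dist_source ht
  have h2 := hγ.dist_target ht
  have h3 := h.dist_add_dist_le z a (γ (gromovProduct a z b)) b
  rw [h1, h2, max_eq_left] at h3
  · simp only [gromovProduct, dist_comm a z, dist_comm b a, dist_comm b z] at *; linarith
  · simp only [gromovProduct, dist_comm b a]; linarith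

theorem isCoarseCenter_projection (h : IsDeltaHyperbolic δ X) {γ : ℝ → X} {a b : X}
    (hγ : IsGeodesicSegment γ a b) (z : X) :
    IsCoarseCenter δ (γ (gromovProduct a z b)) z a b := by
  have ht := gromovProduct_mem_Icc a z b
  have h1 := hγ.dist_source ht
  have h2 := hγ.dist_target ht
  have h3 := h.dist_projection_le hγ z
  refine ⟨?_, (hγ.gromovProduct_eq_zero ht).trans_le (h.delta_nonneg z), ?_⟩
  · simp only [gromovProduct, dist_comm b a, dist_comm b z, dist_comm a z] at *; linarith
  · rw [dist_comm] at h2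
    simp only [gromovProduct, dist_comm b a, dist_comm b z, dist_comm a z] at *; linarith

/-- Coarse centres are coarsely unique: by the four-point condition at `p`, at most one of the
products of `q` with the three vertices is large there, and likewise with `p` and `q` exchanged, so
that for one vertex both products are small; they add up to `d(p, q)`. -/
theorem dist_le_of_isCoarseCenter (h : IsDeltaHyperbolic δ X) {C : ℝ} {p q x y z : X}
    (hp : IsCoarseCenter C p x y z) (hq : IsCoarseCenter C q x y z) :
    dist p q ≤ 2 * C + 2 * δ := by
  have key : ∀ u v w : X, gromovProduct w u v ≤ C → ∀ r,
      gromovProduct w u r ≤ C + δ ∨ gromovProduct w v r ≤ C + δ := by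
    intro u v w huv r
    have := h.four_point w u r v
    rcases min_le_iff.1 (sub_le_iff_le_add.1 (this.trans huv)) with h1 | h1
    · exact Or.inl h1
    · rw [gromovProduct_comm] at h1; exact Or.inr h1
  have sum : ∀ u : X, gromovProduct p u q + gromovProduct q u p = dist p q := by
    intro u; simp only [gromovProduct, dist_comm q p]; ring
  have a1 := key _ _ _ hp.left q
  have a2 := key _ _ _ hp.middle q
  have a3 := key _ _ _ hp.right q
  have b1 := key _ _ _ hq.left p
  have b2 := key _ _ _ hq.middle p
  have b3 := key _ _ _ hq.right p
  have sx := sum x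
  have sy := sum y
  have sz := sum z
  by_contra! hlt
  rcases a1 with a1 | a1 <;> rcases a2 with a2 | a2 <;> rcases a3 with a3 | a3 <;>
  rcases b1 with b1 | b1 <;> rcases b2 with b2 | b2 <;> rcases b3 with b3 | b3 <;> linarith

end IsDeltaHyperbolic

namespace CannonThurston

/-! ### Stability of coarsely connected sets -/

/-- A subset `A` is coarsely path convex if any two of its points `p`, `q` are joined by a chain of
points of `A` with jumps at most `C` and with at most `C d(p, q) + C` steps. -/
def IsChainConvex {X : Type*} [MetricSpace X] (C : ℝ) (A : Set X) : Prop :=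
  ∀ p ∈ A, ∀ q ∈ A, ∃ (n : ℕ) (x : ℕ → X), x 0 = p ∧ x n = q ∧ (n : ℝ) ≤ C * dist p q + C ∧
    (∀ i, x i ∈ A) ∧ ∀ i < n, dist (x i) (x (i + 1)) ≤ C

/-- A chain of at most `2 ^ k` steps that stays at distance `D` from `w` has endpoints whose Gromov
product at `w` is at least `D` up to an error linear in `k`. -/
theorem le_gromovProduct_of_chain {X : Type*} [MetricSpace X] {δ : ℝ} (h : IsDeltaHyperbolic δ X)
    {w : X} {D c : ℝ} (hc : 0 ≤ c) (k : ℕ) : ∀ (n : ℕ) (_ : n ≤ 2 ^ k) (x : ℕ → X)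
    (_ : ∀ i ≤ n, D ≤ dist (x i) w) (_ : ∀ i < n, dist (x i) (x (i + 1)) ≤ c),
    D - c - k * δ ≤ gromovProduct w (x 0) (x n) := by
  have hδ := h.delta_nonneg w
  have base : ∀ n ≤ 1, ∀ (x : ℕ → X) (_ : ∀ i ≤ n, D ≤ dist (x i) w)
      (_ : ∀ i < n, dist (x i) (x (i + 1)) ≤ c), D - c ≤ gromovProduct w (x 0) (x n) := by
    intro n hn x hD hx
    interval_cases n
    · rw [gromovProduct_self]; linarith [hD 0 le_rfl]
    · have := dist_sub_dist_le_gromovProduct w (x 0) (x 1)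
      have := hD 0 (by norm_num)
      have := hx 0 (by norm_num)
      norm_num at *; linarith
  induction k with
  | zero =>
    intro n hn x hD hx
    simpa using base n (by simpa using hn) x hD hx
  | succ k ih =>
    intro n hn x hD hx
    push_cast
    rcases le_total n (2 ^ k) with h1 | h1
    · have := ih n h1 x hD hx
      linarith
    · have e1 := ih (2 ^ k) le_rfl x (fun i hi => hD i (hi.trans h1))
        (fun i hi => hx i (hi.trans_le h1))
      have e2 := ih (n - 2 ^ k) (by rw [pow_succ] at hn; omega) (fun i => x (2 ^ k + i))
        (fun i hi => hD _ (by omega)) (fun i hi => hx _ (by omega))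
      simp only [add_zero, Nat.add_sub_cancel' h1] at e2
      have e3 := h.four_point w (x 0) (x (2 ^ k)) (x n)
      have e4 := le_min e1 e2
      linarith

/-- Logarithmic growth loses against linear growth, in the form used for the stability of
coarsely path convex sets. -/
theorem exists_pow_two_gt (α δ c : ℝ) (hα : 0 ≤ α) (hδ : 0 ≤ δ) : ∃ R : ℝ, 1 ≤ R ∧ ∀ D, R < D →
    ∃ k : ℕ, α * D ≤ 2 ^ k ∧ k * δ + c < D := by
  set m := Real.sqrt α with hm
  have hm0 : 0 ≤ m := Real.sqrt_nonneg _
  set b := 2 * δ * m + 2 * δ + |c| with hb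
  have hb0 : 0 ≤ b := by positivity
  refine ⟨max 1 (b ^ 2), le_max_left _ _, fun D hD => ?_⟩
  have hD1 : 1 < D := (le_max_left _ _).trans_lt hD
  have hD2 : b ^ 2 < D := (le_max_right _ _).trans_lt hD
  set r := Real.sqrt D with hr
  have hr2 : r * r = D := Real.mul_self_sqrt (by linarith)
  have hr0 : 0 ≤ r := Real.sqrt_nonneg _
  have hr1 : 1 ≤ r := by nlinarith
  have hbr : b < r := by nlinarith
  have hm2 : m * m = α := Real.mul_self_sqrt hα
  set j := ⌈m * r⌉₊ with hj
  have hj1 : m * r ≤ j := Nat.le_ceil _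
  have hj2 : (j : ℝ) < m * r + 1 := Nat.ceil_lt_add_one (by positivity)
  have hj3 : (j : ℝ) ≤ 2 ^ j := by exact_mod_cast (Nat.lt_two_pow_self).le
  have hmr : 0 ≤ m * r := by positivity
  refine ⟨2 * j, ?_, ?_⟩
  · calc α * D = (m * r) * (m * r) := by rw [← hr2, ← hm2]; ring
      _ ≤ 2 ^ j * 2 ^ j := by gcongr <;> exact hj1.trans hj3
      _ = 2 ^ (2 * j) := by rw [two_mul, pow_add]
  · push_cast
    have hc := le_abs_self c
    have hc0 := abs_nonneg c
    calc 2 * (j : ℝ) * δ + c ≤ 2 * (m * r + 1) * δ + |c| := by gcongr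
      _ ≤ b * r := by
        rw [hb]
        nlinarith [mul_le_mul_of_nonneg_left hr1 hδ, mul_le_mul_of_nonneg_left hr1 hc0]
      _ < r * r := by nlinarith
      _ = D := hr2

/-- A geodesic with endpoints in a coarsely path convex subset of a hyperbolic space stays in a
uniform neighbourhood of it. At a point of the geodesic at maximal distance `D` from the set, two
points of the geodesic at distance `2 D` on either side are joined by a chain through the set that
avoids a ball of radius about `D` and has about `D` steps, so that `D` is at most about `log D`. -/
theorem exists_dist_le_of_isChainConvex (δ C : ℝ) : ∃ R : ℝ, 0 ≤ R ∧
    ∀ {X : Type*} [MetricSpace X], IsDeltaHyperbolic δ X → ∀ {A : Set X}, IsChainConvex C A →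
    ∀ {p q : X}, p ∈ A → q ∈ A → ∀ {γ : ℝ → X}, IsGeodesicSegment γ p q →
    ∀ t ∈ Set.Icc 0 (dist p q), ∃ a ∈ A, dist (γ t) a ≤ R := by
  obtain ⟨R, hR1, hR⟩ := exists_pow_two_gt (9 * |C|) |δ| (1 + |C| + 2 * |δ|) (by positivity)
    (abs_nonneg _)
  refine ⟨R + 1, by linarith, ?_⟩
  intro X _ h A hA p q hp hq γ hγ t ht
  have hδ := h.delta_nonneg p
  rw [abs_of_nonneg hδ] at hR
  have hC : 0 ≤ C := by
    obtain ⟨n, x, -, -, h1, -⟩ := hA p hp p hp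
    rw [dist_self, mul_zero, zero_add] at h1
    exact (Nat.cast_nonneg n).trans h1
  rw [abs_of_nonneg hC] at hR
  have hne : A.Nonempty := ⟨p, hp⟩
  have hcont : ContinuousOn (fun s => Metric.infDist (γ s) A) (Set.Icc 0 (dist p q)) :=
    (Metric.continuous_infDist_pt A).comp_continuousOn hγ.continuousOn
  obtain ⟨s, hs, hmax⟩ := isCompact_Icc.exists_isMaxOn ⟨t, ht⟩ hcont
  set D := Metric.infDist (γ s) A with hDdef
  have near : ∀ u ∈ Set.Icc 0 (dist p q), ∃ a ∈ A, dist (γ u) a < D + 1 := fun u hu =>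
    (Metric.infDist_lt_iff hne).1 (lt_of_le_of_lt (hmax hu) (lt_add_one D))
  have far : ∀ a ∈ A, D ≤ dist a (γ s) := fun a ha => by
    rw [dist_comm]; exact Metric.infDist_le_dist_of_mem ha
  suffices hD : D ≤ R by
    obtain ⟨a, ha, h1⟩ := near t ht
    exact ⟨a, ha, by linarith⟩
  by_contra! hlt
  obtain ⟨k, hk1, hk2⟩ := hR D hlt
  -- the point of `A` at which the chain starts
  have left : ∃ u ∈ Set.Icc 0 s, s - u ≤ 2 * D ∧ ∃ a ∈ A, dist (γ u) a ≤ D + 1 ∧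
      D - 1 ≤ gromovProduct (γ s) (γ u) a := by
    rcases le_total (s - 2 * D) 0 with h1 | h1
    · refine ⟨0, ⟨le_rfl, hs.1⟩, by linarith, p, hp, ?_, ?_⟩
      · rw [hγ.source, dist_self]; linarith
      · rw [hγ.source, gromovProduct_self]; linarith [far p hp]
    · have hu : s - 2 * D ∈ Set.Icc 0 (dist p q) := ⟨h1, by linarith [hs.2]⟩
      obtain ⟨a, ha, h2⟩ := near _ hu
      refine ⟨s - 2 * D, ⟨h1, by linarith⟩, by linarith, a, ha, h2.le, ?_⟩
      have h3 := dist_sub_dist_le_gromovProduct (γ s) (γ (s - 2 * D)) a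
      rw [hγ.dist_eq _ hu _ hs, abs_of_nonpos (by linarith)] at h3
      linarith
  have right : ∃ u ∈ Set.Icc s (dist p q), u - s ≤ 2 * D ∧ ∃ a ∈ A, dist (γ u) a ≤ D + 1 ∧
      D - 1 ≤ gromovProduct (γ s) (γ u) a := by
    rcases le_total (dist p q) (s + 2 * D) with h1 | h1
    · refine ⟨dist p q, ⟨hs.2, le_rfl⟩, by linarith, q, hq, ?_, ?_⟩
      · rw [hγ.target, dist_self]; linarith
      · rw [hγ.target, gromovProduct_self]; linarith [far q hq]
    · have hu : s + 2 * D ∈ Set.Icc 0 (dist p q) := ⟨by linarith [hs.1], h1⟩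
      obtain ⟨a, ha, h2⟩ := near _ hu
      refine ⟨s + 2 * D, ⟨by linarith, h1⟩, by linarith, a, ha, h2.le, ?_⟩
      have h3 := dist_sub_dist_le_gromovProduct (γ s) (γ (s + 2 * D)) a
      rw [hγ.dist_eq _ hu _ hs, abs_of_nonneg (by linarith)] at h3
      linarith
  obtain ⟨u, hu, hu', a, ha, hua, hgu⟩ := left
  obtain ⟨v, hv, hv', b, hb, hvb, hgv⟩ := right
  have hu2 : u ∈ Set.Icc 0 (dist p q) := ⟨hu.1, hu.2.trans hs.2⟩
  have hv2 : v ∈ Set.Icc 0 (dist p q) := ⟨hs.1.trans hv.1, hv.2⟩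
  have huv : dist (γ u) (γ v) = v - u := by
    rw [hγ.dist_eq _ hu2 _ hv2, abs_sub_comm, abs_of_nonneg (by linarith [hu.2, hv.1])]
  have hab : dist a b ≤ 8 * D := by
    have e1 := dist_triangle4 a (γ u) (γ v) b
    rw [huv, dist_comm a (γ u)] at e1
    linarith
  obtain ⟨n, x, hx0, hxn, hn, hxA, hxd⟩ := hA a ha b hb
  have hn2 : n ≤ 2 ^ k := by
    have : (n : ℝ) ≤ 2 ^ k := by
      refine le_trans ?_ hk1
      nlinarith [mul_le_mul_of_nonneg_left hab hC]
    exact_mod_cast this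
  have hch := le_gromovProduct_of_chain h (w := γ s) hC k n hn2 x (fun i _ => far _ (hxA i)) hxd
  rw [hx0, hxn] at hch
  have f1 := h.four_point (γ s) (γ u) a b
  have f2 := h.four_point (γ s) (γ u) b (γ v)
  have f3 : gromovProduct (γ s) (γ u) (γ v) = 0 := by
    have e1 := hγ.dist_eq _ hu2 _ hs
    have e2 := hγ.dist_eq _ hv2 _ hs
    rw [abs_of_nonpos (by linarith [hu.2])] at e1
    rw [abs_of_nonneg (by linarith [hv.1])] at e2
    simp only [gromovProduct]; linarith
  have hkδ : 0 ≤ k * δ := by positivity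
  have f4 : D - 1 - C - k * δ - δ ≤ gromovProduct (γ s) (γ u) b := by
    refine le_trans ?_ f1
    have := le_min (by linarith : D - 1 - C - k * δ ≤ gromovProduct (γ s) (γ u) a)
      (by linarith : D - 1 - C - k * δ ≤ gromovProduct (γ s) a b)
    linarith
  rw [gromovProduct_comm] at hgv
  have := le_min f4 (by linarith : D - 1 - C - k * δ - δ ≤ gromovProduct (γ s) b (γ v))
  linarith

/-! ### Quasi-isometric embeddings -/

section QuasiIsometry

variable {E Y : Type*} [MetricSpace E] [MetricSpace Y]

/-- A set that contains a geodesic between any two of its points. -/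
def IsGeodesicallyConvex (G : Set E) : Prop :=
  ∀ u ∈ G, ∀ v ∈ G, ∃ γ, IsGeodesicSegment γ u v ∧ ∀ t ∈ Set.Icc 0 (dist u v), γ t ∈ G

theorem isGeodesicallyConvex_univ (h : IsGeodesicMetricSpace E) :
    IsGeodesicallyConvex (Set.univ : Set E) := fun u _ v _ =>
  (exists_isGeodesicSegment h u v).imp fun _ hγ => ⟨hγ, fun _ _ => trivial⟩

theorem IsGeodesicSegment.isGeodesicallyConvex_image {γ : ℝ → E} {u v : E}
    (h : IsGeodesicSegment γ u v) {s t : ℝ} (hs : 0 ≤ s) (ht : t ≤ dist u v) :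
    IsGeodesicallyConvex (γ '' Set.Icc s t) := by
  have aux : ∀ a ∈ Set.Icc s t, ∀ b ∈ Set.Icc s t, a ≤ b → ∃ η, IsGeodesicSegment η (γ a) (γ b) ∧
      ∀ r ∈ Set.Icc 0 (dist (γ a) (γ b)), η r ∈ γ '' Set.Icc s t := by
    intro a ha b hb hab
    refine ⟨_, h.subsegment (hs.trans ha.1) hab (hb.2.trans ht), fun r hr => ⟨a + r, ?_, rfl⟩⟩
    rw [h.dist_eq a ⟨hs.trans ha.1, ha.2.trans ht⟩ b ⟨hs.trans hb.1, hb.2.trans ht⟩, abs_sub_comm,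
      abs_of_nonneg (by linarith)] at hr
    exact ⟨by linarith [ha.1, hr.1], by linarith [hb.2, hr.2]⟩
  rintro _ ⟨a, ha, rfl⟩ _ ⟨b, hb, rfl⟩
  rcases le_total a b with hab | hab
  · exact aux a ha b hb hab
  · obtain ⟨η, h1, h2⟩ := aux b hb a ha hab
    refine ⟨_, h1.symm, fun r hr => h2 _ ?_⟩
    rw [dist_comm] at hr
    exact ⟨by linarith [hr.2], by linarith [hr.1]⟩

theorem _root_.IsQIEmbedding.epsilon_nonneg {K ε : ℝ} {φ : E → Y} (hφ : IsQIEmbedding K ε φ)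
    (z : E) : 0 ≤ ε := by
  have := (hφ z z).2
  simpa using this

theorem _root_.IsQIEmbedding.dist_le {K ε : ℝ} (hK : 0 < K) {φ : E → Y} (hφ : IsQIEmbedding K ε φ)
    (x y : E) : dist x y ≤ K * (dist (φ x) (φ y) + ε) := by
  have := (hφ x y).1
  rw [← div_le_iff₀' hK]
  rw [one_div, inv_mul_eq_div] at this
  linarith

/-- The constant for which the images of geodesically convex sets under `(K, ε)`-quasi-isometric
embeddings are coarsely path convex. -/
def qiChainConstant (K ε : ℝ) : ℝ := K + K * ε + ε + 1

theorem _root_.IsQIEmbedding.isChainConvex_image {K ε : ℝ} (hK : 0 < K) {φ : E → Y}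
    (hφ : IsQIEmbedding K ε φ) {G : Set E} (hG : IsGeodesicallyConvex G) :
    IsChainConvex (qiChainConstant K ε) (φ '' G) := by
  rintro _ ⟨u, hu, rfl⟩ _ ⟨v, hv, rfl⟩
  obtain ⟨γ, hγ, hγG⟩ := hG u hu v hv
  have hε := hφ.epsilon_nonneg u
  have hKε : 0 ≤ K * ε := by positivity
  have hd := hφ.dist_le hK u v
  have hm : ∀ i : ℕ, min (i : ℝ) (dist u v) ∈ Set.Icc 0 (dist u v) := fun i =>
    ⟨le_min (Nat.cast_nonneg i) dist_nonneg, min_le_right _ _⟩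
  refine ⟨⌈dist u v⌉₊, fun i => φ (γ (min i (dist u v))), ?_, ?_, ?_, ?_, ?_⟩
  · simp [hγ.source]
  · simp [min_eq_right (Nat.le_ceil (dist u v)), hγ.target]
  · have := (Nat.ceil_lt_add_one (dist_nonneg (x := u) (y := v))).le
    have h0 := dist_nonneg (x := φ u) (y := φ v)
    have h1 : 0 ≤ (K * ε + ε + 1) * dist (φ u) (φ v) := by positivity
    simp only [qiChainConstant]; linarith
  · exact fun i => ⟨_, hγG _ (hm i), rfl⟩
  · intro i _
    refine (hφ _ _).2.trans ?_
    rw [hγ.dist_eq _ (hm _) _ (hm _)]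
    have : |min (i : ℝ) (dist u v) - min ((i + 1 : ℕ) : ℝ) (dist u v)| ≤ 1 := by
      refine (abs_min_sub_min_le_max _ _ _ _).trans ?_
      simp
    have := mul_le_mul_of_nonneg_left this hK.le
    simp only [qiChainConstant]; linarith

/-- The image of a quasi-isometric embedding of a geodesic space is quasi-convex, and
quasi-isometric embeddings preserve the relation of lying coarsely between two points. -/
theorem exists_qi_constants (δ K ε : ℝ) (hK : 0 < K) : ∃ R : ℝ, 0 ≤ R ∧
    ∀ {E Y : Type*} [MetricSpace E] [MetricSpace Y], IsDeltaHyperbolic δ E →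
    IsDeltaHyperbolic δ Y → ∀ {φ : E → Y}, IsQIEmbedding K ε φ →
    (∀ (u v : E) (γ : ℝ → Y), IsGeodesicSegment γ (φ u) (φ v) →
      ∀ t ∈ Set.Icc 0 (dist (φ u) (φ v)), ∃ z, dist (γ t) (φ z) ≤ R) ∧
    ∀ u v w : E, gromovProduct w u v ≤ δ → gromovProduct (φ w) (φ u) (φ v) ≤ R := by
  obtain ⟨R, hR0, hR⟩ := exists_dist_le_of_isChainConvex δ (qiChainConstant K ε)
  set S := K * (2 * R + 4 * δ + ε) with hS
  refine ⟨max R (R + K * S + ε + K * (3 * δ) + ε), hR0.trans (le_max_left _ _), ?_⟩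
  intro E Y _ _ hE hY φ hφ
  refine ⟨fun u v γ hγ t ht => ?_, fun u v w hw => (le_max_right _ _).trans' ?_⟩
  · obtain ⟨_, ⟨z, -, rfl⟩, hz⟩ := hR hY
      (hφ.isChainConvex_image hK (isGeodesicallyConvex_univ hE.geodesic))
      (Set.mem_image_of_mem φ trivial) (Set.mem_image_of_mem φ trivial) hγ t ht
    exact ⟨z, hz.trans (le_max_left _ _)⟩
  · obtain ⟨γ, hγ⟩ := exists_isGeodesicSegment hE.geodesic u v
    have ht := gromovProduct_mem_Icc u w v
    set t := gromovProduct u w v with htdef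
    have hwd := hE.dist_projection_le hγ w
    rw [← htdef] at hwd
    -- it suffices to treat the point `γ t` of the geodesic nearest to `w`
    suffices hmain : gromovProduct (φ (γ t)) (φ u) (φ v) ≤ R + K * S + ε by
      have h1 := gromovProduct_le_add_base (φ w) (φ (γ t)) (φ u) (φ v)
      have h2 := (hφ w (γ t)).2
      have h3 : K * dist w (γ t) ≤ K * (3 * δ) := by gcongr; linarith
      linarith
    have hε := hφ.epsilon_nonneg u
    obtain ⟨α, hα⟩ := exists_isGeodesicSegment hY.geodesic (φ (γ t)) (φ u)
    obtain ⟨β, hβ⟩ := exists_isGeodesicSegment hY.geodesic (φ (γ t)) (φ v)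
    set c := gromovProduct (φ (γ t)) (φ u) (φ v) with hc
    have hc' : gromovProduct (φ (γ t)) (φ v) (φ u) = c := gromovProduct_comm _ _ _
    have cα := hY.isCoarseCenter_projection hα (φ v)
    have cβ := hY.isCoarseCenter_projection hβ (φ u)
    rw [hc'] at cα
    rw [← hc] at cβ
    have hcα : c ∈ Set.Icc 0 (dist (φ (γ t)) (φ u)) := hc' ▸ gromovProduct_mem_Icc _ _ _
    have hcβ : c ∈ Set.Icc 0 (dist (φ (γ t)) (φ v)) := gromovProduct_mem_Icc _ _ _
    have hαβ : dist (α c) (β c) ≤ 2 * δ + 2 * δ := by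
      refine hY.dist_le_of_isCoarseCenter (x := φ v) (y := φ (γ t)) (z := φ u) cα ⟨?_, ?_, ?_⟩
      · rw [gromovProduct_comm]; exact cβ.middle
      · rw [gromovProduct_comm]; exact cβ.left
      · rw [gromovProduct_comm]; exact cβ.right
    obtain ⟨_, ⟨_, ⟨s₁, hs₁, rfl⟩, rfl⟩, h1⟩ := hR hY
      (hφ.isChainConvex_image hK (hγ.isGeodesicallyConvex_image le_rfl ht.2))
      ⟨_, ⟨t, ⟨ht.1, le_rfl⟩, rfl⟩, rfl⟩ ⟨_, ⟨0, ⟨le_rfl, ht.1⟩, rfl⟩, congrArg φ hγ.source⟩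
      hα c hcα
    obtain ⟨_, ⟨_, ⟨s₂, hs₂, rfl⟩, rfl⟩, h2⟩ := hR hY
      (hφ.isChainConvex_image hK (hγ.isGeodesicallyConvex_image ht.1 le_rfl))
      ⟨_, ⟨t, ⟨le_rfl, ht.2⟩, rfl⟩, rfl⟩ ⟨_, ⟨dist u v, ⟨ht.2, le_rfl⟩, rfl⟩, congrArg φ hγ.target⟩
      hβ c hcβ
    have hs₁' : s₁ ∈ Set.Icc 0 (dist u v) := ⟨hs₁.1, hs₁.2.trans ht.2⟩
    have hs₂' : s₂ ∈ Set.Icc 0 (dist u v) := ⟨ht.1.trans hs₂.1, hs₂.2⟩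
    have h3 := hφ.dist_le hK (γ s₁) (γ s₂)
    rw [hγ.dist_eq _ hs₁' _ hs₂', abs_sub_comm,
      abs_of_nonneg (by linarith [hs₁.2, hs₂.1])] at h3
    have h4 := dist_triangle4 (φ (γ s₁)) (α c) (β c) (φ (γ s₂))
    rw [dist_comm (φ (γ s₁)) (α c)] at h4
    have h5 : s₂ - s₁ ≤ S := h3.trans (by rw [hS]; gcongr; linarith)
    have h6 := (hφ (γ t) (γ s₁)).2
    rw [hγ.dist_eq _ ht _ hs₁', abs_of_nonneg (by linarith [hs₁.2])] at h6
    have h7 : K * (t - s₁) ≤ K * S := by gcongr; linarith [hs₂.1]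
    have h8 := hα.dist_source hcα
    have h9 := dist_triangle_right (φ (γ t)) (α c) (φ (γ s₁))
    linarith

end QuasiIsometry

/-! ### Projections to quasi-convex subsets and to geodesics -/

section Projection

variable {E Y : Type*} [MetricSpace Y]

theorem exists_nearly_nearest [Nonempty E] (φ : E → Y) (a : Y) :
    ∃ z₀, ∀ z, dist a (φ z₀) ≤ dist a (φ z) + 1 := by
  have hb : BddBelow (Set.range fun z => dist a (φ z)) :=
    ⟨0, by rintro _ ⟨z, rfl⟩; exact dist_nonneg⟩
  obtain ⟨z₀, h⟩ := exists_lt_of_ciInf_lt (lt_add_one (⨅ z, dist a (φ z)))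
  exact ⟨z₀, fun z => h.le.trans (by gcongr; exact ciInf_le hb z)⟩

/-- Geodesics between points of the range of `φ` lie in its `R`-neighbourhood. -/
def HasQuasiconvexRange (R : ℝ) (φ : E → Y) : Prop :=
  ∀ (u v : E) (γ : ℝ → Y), IsGeodesicSegment γ (φ u) (φ v) →
    ∀ t ∈ Set.Icc 0 (dist (φ u) (φ v)), ∃ z, dist (γ t) (φ z) ≤ R

theorem gromovProduct_le_of_nearly_nearest {δ R : ℝ} (hY : IsDeltaHyperbolic δ Y) {φ : E → Y}
    (hφ : HasQuasiconvexRange R φ) {a : Y} {z₀ : E}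
    (h : ∀ z, dist a (φ z₀) ≤ dist a (φ z) + 1) (z : E) :
    gromovProduct (φ z₀) a (φ z) ≤ 1 + 2 * δ + R := by
  obtain ⟨γ, hγ⟩ := exists_isGeodesicSegment hY.geodesic (φ z₀) (φ z)
  obtain ⟨z', hz'⟩ := hφ _ _ γ hγ _ (gromovProduct_mem_Icc (φ z₀) a (φ z))
  have h1 := hY.dist_projection_le hγ a
  have h2 := h z'
  have h3 := dist_triangle a (γ (gromovProduct (φ z₀) a (φ z))) (φ z')
  have h4 : gromovProduct a (φ z₀) (φ z) + gromovProduct (φ z₀) a (φ z) = dist a (φ z₀) := by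
    simp only [gromovProduct, dist_comm (φ z₀) a, dist_comm (φ z) a, dist_comm (φ z) (φ z₀)]; ring
  linarith

/-- If the projections of `x` and `y` to a geodesic are far apart, then the geodesics from `x` to
`y` pass close to these projections. -/
theorem gromovProduct_projection_le {δ : ℝ} (hY : IsDeltaHyperbolic δ Y) {γ : ℝ → Y} {a b : Y}
    (hγ : IsGeodesicSegment γ a b) {x y : Y}
    (h : gromovProduct a x b + 3 * δ < gromovProduct a y b) :
    gromovProduct (γ (gromovProduct a x b)) x y ≤ 2 * δ := by
  have hs := gromovProduct_mem_Icc a x b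
  have ht := gromovProduct_mem_Icc a y b
  have cx := (hY.isCoarseCenter_projection hγ x).right
  have cy := (hY.isCoarseCenter_projection hγ y).left
  set s := gromovProduct a x b
  set t := gromovProduct a y b
  have h1 := hγ.dist_source hs
  have h2 := hγ.dist_target hs
  have h3 := hγ.dist_source ht
  have h4 := hγ.dist_target ht
  have h5 := dist_triangle y (γ s) a
  have h6 := dist_triangle y (γ t) b
  rw [dist_comm] at h2
  rw [dist_comm (γ s) a] at h5
  have h7 : t - s - δ ≤ gromovProduct (γ s) y b := by
    simp only [gromovProduct] at cy ⊢; linarith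
  have h8 := hY.four_point (γ s) x y b
  rcases min_le_iff.1 (sub_le_iff_le_add.1 (h8.trans cx)) with h9 | h9 <;> linarith

/-- If a geodesic stays away from a quasi-convex set, then the set has a projection of bounded
diameter to the geodesic. -/
theorem abs_projection_sub_le_of_far {δ R : ℝ} (hY : IsDeltaHyperbolic δ Y) {φ : E → Y}
    (hφ : HasQuasiconvexRange R φ) {γ : ℝ → Y} {a b : Y} (hγ : IsGeodesicSegment γ a b)
    (h : ∀ s ∈ Set.Icc 0 (dist a b), ∀ z, 4 * δ + R < dist (γ s) (φ z)) (z z' : E) :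
    |gromovProduct a (φ z) b - gromovProduct a (φ z') b| ≤ 3 * δ := by
  have key : ∀ z z' : E, gromovProduct a (φ z') b ≤ gromovProduct a (φ z) b + 3 * δ := by
    intro z z'
    by_contra! hlt
    have h1 := gromovProduct_projection_le hY hγ hlt
    set p := γ (gromovProduct a (φ z) b) with hp
    obtain ⟨η, hη⟩ := exists_isGeodesicSegment hY.geodesic (φ z) (φ z')
    have h2 := hY.dist_projection_le hη p
    obtain ⟨w, hw⟩ := hφ _ _ η hη _ (gromovProduct_mem_Icc (φ z) p (φ z'))
    have h3 := h _ (gromovProduct_mem_Icc a (φ z) b) w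
    have h4 := dist_triangle p (η (gromovProduct (φ z) p (φ z'))) (φ w)
    linarith
  rw [abs_le]
  constructor <;> linarith [key z z', key z' z]

/-- Let `a'`, `b'` be coarse projections of `a`, `b` to a set that comes close to the geodesics
from `a` to `b`. For a point `x` of this set, coarse centres of `x, a', b'` are coarse centres
of `x, a, b`. -/
theorem isCoarseCenter_of_projection {C₀ C₁ C₂ : ℝ} {a b a' b' x m : Y}
    (hC₂ : 0 ≤ C₂)
    (hm : IsCoarseCenter C₀ m x a' b') (hax : gromovProduct a' a x ≤ C₁)
    (hbx : gromovProduct b' b x ≤ C₁) (hab' : gromovProduct a' a b' ≤ C₁)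
    (hab : gromovProduct b' a b ≤ C₂) : IsCoarseCenter (C₀ + C₁ + C₂) m x a b := by
  have h1 := hm.left
  have h2 := hm.middle
  have h3 := hm.right
  have t1 := dist_triangle a a' m
  have t2 := dist_triangle b b' m
  have t3 := dist_comm x a
  have t4 := dist_comm x b
  simp only [gromovProduct, dist_comm b' a'] at *
  constructor <;> simp only [gromovProduct] <;> linarith

end Projection

/-! ### One step of the ladder -/

section Step

/-- `ρ : Y → X` is the projection of `Y` onto a geodesic segment of `Y`, followed by the inclusion
`ι : Y → X`, where all points of the segment are at distance at most `D` from `Λ` in `X`. -/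
def IsLadderMap {X Y : Type*} [MetricSpace X] [MetricSpace Y] (ι : Y → X) (Λ : Set X) (D : ℝ)
    (ρ : Y → X) : Prop :=
  ∃ (a b : Y) (γ : ℝ → Y), IsGeodesicSegment γ a b ∧
    (∀ y, ρ y = ι (γ (gromovProduct a y b))) ∧
    ∀ s ∈ Set.Icc 0 (dist a b), ∃ p ∈ Λ, dist (ι (γ s)) p ≤ D

/-- The ladder can be continued across an edge space `E`. If the segment in `Y` comes close to the
image of `E`, its endpoints are projected to this image and transported to `Y'`, and the next
segment is a geodesic between the resulting points. Otherwise the image of `E` has a bounded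
projection to the segment, and the next map may be constant. -/
theorem exists_ladder_step.{u} (δ K ε : ℝ) (hK : 0 < K) : ∃ C : ℝ, 0 ≤ C ∧
    ∀ {X E Y Y' : Type u} [MetricSpace X] [MetricSpace E] [MetricSpace Y] [MetricSpace Y']
    [Nonempty E], IsDeltaHyperbolic δ E → IsDeltaHyperbolic δ Y → IsDeltaHyperbolic δ Y' →
    ∀ {φ : E → Y} {ψ : E → Y'}, IsQIEmbedding K ε φ → IsQIEmbedding K ε ψ →
    ∀ {ι : Y → X} {ι' : Y' → X}, (∀ x y, dist (ι x) (ι y) ≤ dist x y) →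
    (∀ x y, dist (ι' x) (ι' y) ≤ dist x y) → (∀ z, dist (ι (φ z)) (ι' (ψ z)) ≤ 1) →
    ∀ {Λ : Set X} {D : ℝ} {ρ : Y → X}, IsLadderMap ι Λ D ρ → ∃ ρ' : Y' → X,
      (∀ z, dist (ρ (φ z)) (ρ' (ψ z)) ≤ C) ∧
      (IsLadderMap ι' Λ (D + C) ρ' ∨ ∃ y, ∀ y', ρ' y' = ρ y) := by
  obtain ⟨R, hR0, hR⟩ := exists_qi_constants δ K ε hK
  set C₁ := 1 + 2 * δ + R with hC₁
  set C₂ := C₁ + (4 * δ + R) with hC₂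
  set C₃ := R + C₁ + C₂ with hC₃
  set C₄ := (2 * C₃ + 2 * δ) + 1 + (2 * max R δ + 2 * δ) with hC₄
  refine ⟨max 0 (C₄ + R), le_max_left _ _, ?_⟩
  intro X E Y Y' _ _ _ _ hne hE hY hY' φ ψ hφ hψ ι ι' hι hι' hιι Λ D ρ hρ
  obtain ⟨a, b, γ, hγ, hρ, hΛ⟩ := hρ
  have hδ := hY.delta_nonneg a
  have hC4 : 0 ≤ C₄ := by
    have := le_max_left R δ
    simp only [hC₄, hC₃, hC₂, hC₁]; linarith
  have hC4' : C₄ ≤ max 0 (C₄ + R) := (le_max_right _ _).trans' (by linarith)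
  obtain ⟨hφ1, hφ2⟩ := hR hE hY hφ
  obtain ⟨hψ1, hψ2⟩ := hR hE hY' hψ
  by_cases hnear : ∀ s ∈ Set.Icc 0 (dist a b), ∀ z, 4 * δ + R < dist (γ s) (φ z)
  · obtain ⟨z₀⟩ := hne
    refine ⟨fun _ => ρ (φ z₀), fun z => hC4'.trans' ?_, Or.inr ⟨_, fun _ => rfl⟩⟩
    have h1 := abs_projection_sub_le_of_far hY hφ1 hγ hnear z z₀
    rw [hρ, hρ]
    refine (hι _ _).trans ?_
    rw [hγ.dist_eq _ (gromovProduct_mem_Icc _ _ _) _ (gromovProduct_mem_Icc _ _ _)]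
    have := le_max_left R δ
    simp only [hC₄, hC₃, hC₂, hC₁]; linarith
  · push Not at hnear
    obtain ⟨s, hs, c, hc⟩ := hnear
    obtain ⟨za, hza⟩ := exists_nearly_nearest φ a
    obtain ⟨zb, hzb⟩ := exists_nearly_nearest φ b
    have pa := gromovProduct_le_of_nearly_nearest hY hφ1 hza
    have pb := gromovProduct_le_of_nearly_nearest hY hφ1 hzb
    have pab : gromovProduct (φ zb) a b ≤ C₂ := by
      have h1 := pb c
      have h2 := hγ.dist_source hs
      have h3 := hγ.dist_target hs
      have h4 := dist_triangle4 a (γ s) (φ c) (φ zb)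
      have h5 := dist_triangle b (γ s) (φ c)
      rw [dist_comm b (γ s)] at h5
      simp only [gromovProduct] at h1 ⊢
      linarith
    obtain ⟨γ', hγ'⟩ := exists_isGeodesicSegment hY'.geodesic (ψ za) (ψ zb)
    obtain ⟨η, hη⟩ := exists_isGeodesicSegment hE.geodesic za zb
    set ρ' : Y' → X := fun y => ι' (γ' (gromovProduct (ψ za) y (ψ zb))) with hρ'
    have hcomm : ∀ z, dist (ρ (φ z)) (ρ' (ψ z)) ≤ C₄ := by
      intro z
      have hw := hE.isCoarseCenter_projection hη z
      set w := η (gromovProduct za z zb)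
      have c1 : IsCoarseCenter C₃ (φ w) (φ z) a b :=
        isCoarseCenter_of_projection (by linarith)
          ⟨hφ2 _ _ _ hw.left, hφ2 _ _ _ hw.middle, hφ2 _ _ _ hw.right⟩ (pa z) (pb z) (pa zb) pab
      have c2 : IsCoarseCenter (max R δ) (ψ w) (ψ z) (ψ za) (ψ zb) :=
        IsCoarseCenter.mono ⟨hψ2 _ _ _ hw.left, hψ2 _ _ _ hw.middle, hψ2 _ _ _ hw.right⟩
          (le_max_left _ _)
      have d1 := hY.dist_le_of_isCoarseCenter
        ((hY.isCoarseCenter_projection hγ (φ z)).mono (by linarith : δ ≤ C₃)) c1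
      have d2 := hY'.dist_le_of_isCoarseCenter c2
        ((hY'.isCoarseCenter_projection hγ' (ψ z)).mono (le_max_right _ _))
      have d3 := dist_triangle4 (ρ (φ z)) (ι (φ w)) (ι' (ψ w)) (ρ' (ψ z))
      have d4 : dist (ρ (φ z)) (ι (φ w)) ≤ 2 * C₃ + 2 * δ := by
        rw [hρ]; exact (hι _ _).trans d1
      have d5 := (hι' _ _).trans d2
      have d6 := hιι w
      linarith
    refine ⟨ρ', fun z => (hcomm z).trans hC4', Or.inl ⟨_, _, γ', hγ', fun _ => rfl, ?_⟩⟩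
    -- a point of the new segment is near some `ψ w`, and it is fixed by `ρ'`
    intro t ht
    obtain ⟨w, hw⟩ := hψ1 _ _ γ' hγ' t ht
    obtain ⟨p, hp, hp'⟩ := hΛ _ (gromovProduct_mem_Icc a (φ w) b)
    refine ⟨p, hp, ?_⟩
    have e1 : ι' (γ' t) = ρ' (γ' t) := by rw [hρ']; simp only [hγ'.gromovProduct_apply ht]
    have e2 : dist (ρ' (γ' t)) (ρ' (ψ w)) ≤ R :=
      ((hι' _ _).trans (hγ'.dist_projection_le _ _)).trans hw
    have e3 := hcomm w
    have e5 := dist_triangle4 (ρ' (γ' t)) (ρ' (ψ w)) (ρ (φ w)) p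
    rw [dist_comm (ρ' (ψ w))] at e5
    rw [← hρ] at hp'
    have e6 := le_max_right 0 (C₄ + R)
    rw [e1]
    linarith

end Step

/-! ### The ladder over a sequence of spaces -/

/-- The ladder over a sequence of hyperbolic spaces glued along quasi-isometrically embedded edge
spaces: maps `ρ n : Y n → X` that start with the projection to a given geodesic `γ` of `Y 0`, are
compatible across the edge spaces up to a bounded error, and whose values are fixed points at some
level `k`, at distance at most `k C` from `γ`. -/
theorem exists_ladder.{u} (δ K ε : ℝ) (hK : 0 < K) : ∃ C : ℝ, 0 ≤ C ∧
    ∀ {X : Type u} [MetricSpace X] {Y E : ℕ → Type u} [∀ n, MetricSpace (Y n)]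
    [∀ n, MetricSpace (E n)] [∀ n, Nonempty (E n)], (∀ n, IsDeltaHyperbolic δ (Y n)) →
    (∀ n, IsDeltaHyperbolic δ (E n)) → ∀ {φ : ∀ n, E n → Y n} {ψ : ∀ n, E n → Y (n + 1)},
    (∀ n, IsQIEmbedding K ε (φ n)) → (∀ n, IsQIEmbedding K ε (ψ n)) → ∀ {ι : ∀ n, Y n → X},
    (∀ n x y, dist (ι n x) (ι n y) ≤ dist x y) →
    (∀ n z, dist (ι n (φ n z)) (ι (n + 1) (ψ n z)) ≤ 1) →
    ∀ {a b : Y 0} {γ : ℝ → Y 0}, IsGeodesicSegment γ a b → ∃ ρ : ∀ n, Y n → X,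
      (∀ y, ρ 0 y = ι 0 (γ (gromovProduct a y b))) ∧
      (∀ n y y', dist (ρ n y) (ρ n y') ≤ dist y y') ∧
      (∀ n z, dist (ρ n (φ n z)) (ρ (n + 1) (ψ n z)) ≤ C) ∧
      ∀ n y, ∃ (k : ℕ) (y' : Y k), ρ n y = ι k y' ∧ ρ k y' = ι k y' ∧
        ∃ s ∈ Set.Icc 0 (dist a b), dist (ι k y') (ι 0 (γ s)) ≤ C * k := by
  obtain ⟨C, hC, hstep⟩ := exists_ladder_step.{u} δ K ε hK
  refine ⟨C, hC, ?_⟩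
  intro X _ Y E _ _ _ hY hE φ ψ hφ hψ ι hι hιι a b γ hγ
  set Λ : Set X := (fun s => ι 0 (γ s)) '' Set.Icc 0 (dist a b) with hΛ
  let Good : ∀ n, (Y n → X) → Prop := fun n ρ =>
    IsLadderMap (ι n) Λ (C * n) ρ ∨ ∃ x, ∀ y, ρ y = x
  have step : ∀ n (p : {ρ : Y n → X // Good n ρ}), ∃ ρ' : {ρ : Y (n + 1) → X // Good (n + 1) ρ},
      (∀ z, dist (p.1 (φ n z)) (ρ'.1 (ψ n z)) ≤ C) ∧
      (IsLadderMap (ι (n + 1)) Λ (C * (n + 1 : ℕ)) ρ'.1 ∨ ∃ y, ∀ y', ρ'.1 y' = p.1 y) := by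
    rintro n ⟨ρ, h | ⟨x, hx⟩⟩
    · obtain ⟨ρ', h1, h2⟩ := hstep (hE n) (hY n) (hY (n + 1)) (hφ n) (hψ n) (hι n) (hι (n + 1))
        (hιι n) h
      have e : C * n + C = C * (n + 1 : ℕ) := by push_cast; ring
      rw [e] at h2
      exact ⟨⟨ρ', h2.imp id fun ⟨y, hy⟩ => ⟨_, hy⟩⟩, h1, h2⟩
    · obtain ⟨z⟩ := ‹∀ n, Nonempty (E n)› n
      exact ⟨⟨fun _ => x, Or.inr ⟨x, fun _ => rfl⟩⟩, fun z => by simp [hx, hC],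
        Or.inr ⟨φ n z, fun _ => (hx _).symm⟩⟩
  have h0 : IsLadderMap (ι 0) Λ (C * (0 : ℕ)) fun y => ι 0 (γ (gromovProduct a y b)) :=
    ⟨a, b, γ, hγ, fun _ => rfl, fun s hs => ⟨_, ⟨s, hs, rfl⟩, by simp⟩⟩
  choose next hnext using step
  let F : ∀ n, {ρ : Y n → X // Good n ρ} := fun n =>
    Nat.rec (motive := fun n => {ρ : Y n → X // Good n ρ}) ⟨_, Or.inl h0⟩ next n
  have hF : ∀ n, F (n + 1) = next n (F n) := fun n => rfl
  have fixed : ∀ n, IsLadderMap (ι n) Λ (C * n) (F n).1 → ∀ y, ∃ (k : ℕ) (y' : Y k),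
      (F n).1 y = ι k y' ∧ (F k).1 y' = ι k y' ∧
        ∃ s ∈ Set.Icc 0 (dist a b), dist (ι k y') (ι 0 (γ s)) ≤ C * k := by
    rintro n ⟨a', b', η, hη, h1, h2⟩ y
    have ht := gromovProduct_mem_Icc a' y b'
    obtain ⟨_, ⟨s, hs, rfl⟩, h3⟩ := h2 _ ht
    exact ⟨n, _, h1 y, by rw [h1, hη.gromovProduct_apply ht], s, hs, h3⟩
  refine ⟨fun n => (F n).1, fun y => rfl, ?_, ?_, ?_⟩
  · intro n y y'
    rcases (F n).2 with ⟨a', b', η, hη, h1, -⟩ | ⟨x, hx⟩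
    · simp only [h1]
      exact (hι n _ _).trans (hη.dist_projection_le _ _)
    · simp [hx]
  · intro n z
    exact (hnext n (F n)).1 z
  · intro n
    induction n with
    | zero => exact fixed 0 h0
    | succ n ih =>
      intro y
      rcases (hnext n (F n)).2 with h | ⟨y₁, h⟩
      · exact fixed (n + 1) h y
      · obtain ⟨k, y', h1, h2⟩ := ih y₁
        exact ⟨k, y', (h y).trans h1, h2⟩

end CannonThurston

/-! ### The ladder in a tree of spaces -/

namespace LinearTree

/-- The vertex `n ≥ 0`. -/
def nonnegVertex (T : LinearTree) : ℕ → T.Vertex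
  | 0 => T.root
  | n + 1 => (nonnegVertex T n).succ

/-- The vertex `-n ≤ 0` of the line. -/
def nonposVertex : ℕ → line.Vertex
  | 0 => line.root
  | n + 1 => ⟨-(n + 1 : ℕ), trivial⟩

theorem pos_root (T : LinearTree) : T.root.pos = 0 := by
  cases T <;> simp [root, Vertex.pos]

theorem pos_nonnegVertex (T : LinearTree) (n : ℕ) : (T.nonnegVertex n).pos = n := by
  induction n with
  | zero => simpa [nonnegVertex] using T.pos_root
  | succ n ih => simp [nonnegVertex, Vertex.pos_succ, ih]

theorem pos_nonposVertex (n : ℕ) : (nonposVertex n).pos = -n := by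
  cases n <;> simp [nonposVertex, Vertex.pos, root]

theorem Vertex.pos_injective {T : LinearTree} : Function.Injective (Vertex.pos (T := T)) :=
  fun _ _ h => Subtype.ext (Int.cast_injective h)

theorem eq_nonnegVertex {T : LinearTree} (v : T.Vertex) (h : 0 ≤ v.pos) :
    ∃ n, v = T.nonnegVertex n := by
  refine ⟨v.1.toNat, Vertex.pos_injective ?_⟩
  have h1 : 0 ≤ v.1 := by
    have h : (0 : ℝ) ≤ (v.1 : ℝ) := h
    exact_mod_cast h
  rw [pos_nonnegVertex, Vertex.pos]
  exact_mod_cast (Int.toNat_of_nonneg h1).symm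

theorem eq_nonposVertex (v : line.Vertex) (h : v.pos < 0) :
    ∃ n, v = nonposVertex (n + 1) := by
  have h1 : v.1 < 0 := by
    have h : (v.1 : ℝ) < 0 := h
    exact_mod_cast h
  refine ⟨(-v.1 - 1).toNat, Vertex.pos_injective ?_⟩
  rw [pos_nonposVertex, Vertex.pos]
  have h2 : ((-v.1 - 1).toNat : ℤ) = -v.1 - 1 := Int.toNat_of_nonneg (by omega)
  have h3 : (((-v.1 - 1).toNat : ℤ) : ℝ) = -v.1 - 1 := by rw [h2]; push_cast; ring
  push_cast at h3 ⊢
  rw [h3]; ring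

theorem succ_nonposVertex (n : ℕ) : (nonposVertex (n + 1)).succ = nonposVertex n :=
  Vertex.pos_injective (by
    rw [Vertex.pos_succ, pos_nonposVertex, pos_nonposVertex]; push_cast; ring)

end LinearTree

namespace TreeOfHyperbolicSpaces

open CannonThurston

variable {X : Type*} [MetricSpace X] {T : LinearTree} (S : TreeOfHyperbolicSpaces X T)

/-- The edge space `X_e` with the induced path metric. -/
abbrev EdgeSpace (e : T.Vertex) : Type _ := PathSpace (S.P ⁻¹' {e.pos + 1 / 2})

theorem dist_val_le {A : Set X} [RectifiablyConnected A] (x y : PathSpace A) :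
    dist x.val y.val ≤ dist x y := by
  rw [dist_edist]
  exact ENNReal.toReal_mono (RectifiablyConnected.ne_top _ x.mem _ y.mem)
    (edist_le_pathEDist A x.val y.val)

theorem P_val {v : T.Vertex} (y : S.VertexSpace v) : S.P y.val = v.pos := y.mem

instance (e : T.Vertex) : Nonempty (S.EdgeSpace e) := by
  have h : e.pos + 1 / 2 ∈ T.carrier := by
    have := e.2
    cases T
    · change (0 : ℝ) ≤ (e.1 : ℝ) at this
      change (0 : ℝ) ≤ (e.1 : ℝ) + 1 / 2
      linarith
    · trivial
  rw [← S.range_P] at h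
  obtain ⟨x, hx⟩ := h
  exact ⟨⟨x, hx⟩⟩

theorem dist_f_le_one (e : T.Vertex) (z : S.EdgeSpace e) (s t : unitInterval) :
    dist (S.f e (z, s)) (S.f e (z, t)) ≤ 1 := by
  have h1 : ∀ p ∈ Set.Ioo (0 : unitInterval) 1 ×ˢ Set.Ioo (0 : unitInterval) 1,
      dist (S.f e (z, p.1)) (S.f e (z, p.2)) ≤ 1 := by
    rintro ⟨s, t⟩ ⟨hs, ht⟩
    have h2 := edist_le_pathEDist (S.P ⁻¹' Set.Ioo e.pos (e.pos + 1)) (S.f e (z, s)) (S.f e (z, t))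
    rw [S.f_isometry e z z s hs t ht, dist_self, edist_dist,
      ENNReal.ofReal_le_ofReal_iff (Real.sqrt_nonneg _)] at h2
    refine h2.trans ?_
    rw [zero_pow two_ne_zero, zero_add, Real.sqrt_sq dist_nonneg, Subtype.dist_eq]
    exact Real.dist_le_of_mem_Icc_01 s.2 t.2
  have hcl : IsClosed {p : unitInterval × unitInterval |
      dist (S.f e (z, p.1)) (S.f e (z, p.2)) ≤ 1} :=
    isClosed_le (((S.continuous_f e).comp (by fun_prop)).dist ((S.continuous_f e).comp
      (by fun_prop))) continuous_const
  have h2 := closure_minimal h1 hcl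
  rw [closure_prod_eq, closure_Ioo zero_ne_one] at h2
  exact h2 (show (s, t) ∈ _ from ⟨⟨unitInterval.nonneg', unitInterval.le_one'⟩,
    ⟨unitInterval.nonneg', unitInterval.le_one'⟩⟩)

/-- The ladder over one side `v 0, v 1, …` of the tree, as a map defined on the whole space. The
edges `e n` between `v n` and `v (n + 1)` may have either orientation. -/
theorem exists_half_ladder : ∃ C : ℝ, 0 ≤ C ∧ ∀ (v e : ℕ → T.Vertex),
    (∀ n, (v n = e n ∧ v (n + 1) = (e n).succ) ∨ (v n = (e n).succ ∧ v (n + 1) = e n)) →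
    Function.Injective v → ∀ (a b : S.VertexSpace (v 0)) (γ : ℝ → S.VertexSpace (v 0)),
    IsGeodesicSegment γ a b → ∃ r : X → X,
      (∀ y : S.VertexSpace (v 0), r y.val = (γ (gromovProduct a y b)).val) ∧
      (∀ n (y y' : S.VertexSpace (v n)), dist (r y.val) (r y'.val) ≤ dist y y') ∧
      (∀ n (z : S.EdgeSpace (e n)), dist (r (S.f (e n) (z, 0))) (r (S.f (e n) (z, 1))) ≤ C) ∧
      ∀ n (y : S.VertexSpace (v n)), ∃ (k : ℕ) (y' : S.VertexSpace (v k)), r y.val = y'.val ∧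
        r y'.val = y'.val ∧ ∃ s ∈ Set.Icc 0 (dist a b), dist y'.val (γ s).val ≤ C * k := by
  obtain ⟨C, hC, h⟩ := exists_ladder S.δ S.K S.ε S.K_pos
  refine ⟨C, hC, fun v e hve hinj a b γ hγ => ?_⟩
  have hmaps : ∀ n, ∃ (φ : S.EdgeSpace (e n) → S.VertexSpace (v n))
      (ψ : S.EdgeSpace (e n) → S.VertexSpace (v (n + 1))),
      IsQIEmbedding S.K S.ε φ ∧ IsQIEmbedding S.K S.ε ψ ∧
      ((∀ z, (φ z).val = S.f (e n) (z, 0) ∧ (ψ z).val = S.f (e n) (z, 1)) ∨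
        ∀ z, (φ z).val = S.f (e n) (z, 1) ∧ (ψ z).val = S.f (e n) (z, 0)) := by
    intro n
    rcases hve n with ⟨h1, h2⟩ | ⟨h1, h2⟩
    · rw [h1, h2]
      exact ⟨_, _, S.qi_initial (e n), S.qi_terminal (e n), Or.inl fun z => ⟨rfl, rfl⟩⟩
    · rw [h1, h2]
      exact ⟨_, _, S.qi_terminal (e n), S.qi_initial (e n), Or.inr fun z => ⟨rfl, rfl⟩⟩
  choose φ ψ hφ hψ hf using hmaps
  obtain ⟨ρ, h0, h1, h2, h3⟩ := h (Y := fun n => S.VertexSpace (v n))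
    (E := fun n => S.EdgeSpace (e n)) (fun n => S.vertex_hyperbolic (v n))
    (fun n => S.edge_hyperbolic (e n)) hφ hψ (ι := fun n y => y.val) (fun n => dist_val_le)
    (fun n z => by
      rcases hf n with h | h <;> simp only [(h z).1, (h z).2] <;> exact S.dist_f_le_one _ _ _ _) hγ
  have hval : Function.Injective fun p : Σ n, S.VertexSpace (v n) => p.2.val := by
    rintro ⟨m, y⟩ ⟨n, y'⟩ (heq : y.val = y'.val)
    have : v m = v n := LinearTree.Vertex.pos_injective (by rw [← S.P_val y, ← S.P_val y', heq])
    obtain rfl := hinj this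
    rw [PathSpace.ext heq]
  set r : X → X := Function.extend (fun p : Σ n, S.VertexSpace (v n) => p.2.val)
    (fun p => ρ p.1 p.2) id
  have hr : ∀ n (y : S.VertexSpace (v n)), r y.val = ρ n y := fun n y =>
    hval.extend_apply _ _ (⟨n, y⟩ : Σ n, S.VertexSpace (v n))
  refine ⟨r, fun y => (hr 0 y).trans (h0 y), fun n y y' => ?_, fun n z => ?_, fun n y => ?_⟩
  · rw [hr, hr]; exact h1 n y y'
  · have := h2 n z
    rw [← hr, ← hr] at this
    rcases hf n with h | h
    · rwa [(h z).1, (h z).2] at this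
    · rwa [(h z).1, (h z).2, dist_comm] at this
  · obtain ⟨k, y', h4, h5, h6⟩ := h3 n y
    exact ⟨k, y', (hr n y).trans h4, (hr k y').trans h5, h6⟩

/-- The ladder of a geodesic `γ` in the root space, as a coarse retraction `ρ` of the union of the
vertex spaces. -/
theorem exists_vertex_retraction : ∃ C : ℝ, 0 ≤ C ∧ ∀ (a b : S.VertexSpace T.root)
    (γ : ℝ → S.VertexSpace T.root), IsGeodesicSegment γ a b → ∃ ρ : X → X,
      (∀ y : S.VertexSpace T.root, ρ y.val = (γ (gromovProduct a y b)).val) ∧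
      (∀ v (y y' : S.VertexSpace v), dist (ρ y.val) (ρ y'.val) ≤ dist y y') ∧
      (∀ e (z : S.EdgeSpace e), dist (ρ (S.f e (z, 0))) (ρ (S.f e (z, 1))) ≤ C) ∧
      ∀ v (y : S.VertexSpace v), ∃ (w : T.Vertex) (y' : S.VertexSpace w), ρ y.val = y'.val ∧
        ρ y'.val = y'.val ∧ ∃ s ∈ Set.Icc 0 (dist a b), dist y'.val (γ s).val ≤ C * |w.pos| := by
  obtain ⟨C, hC, h⟩ := S.exists_half_ladder
  refine ⟨C, hC, fun a b γ hγ => ?_⟩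
  obtain ⟨r, h0, h1, h2, h3⟩ := h T.nonnegVertex T.nonnegVertex (fun n => Or.inl ⟨rfl, rfl⟩)
    (fun m n hmn => by
      have := congrArg LinearTree.Vertex.pos hmn
      simpa [LinearTree.pos_nonnegVertex] using this) a b γ hγ
  cases T with
  | ray =>
    have key : ∀ v : LinearTree.ray.Vertex, ∃ n, v = LinearTree.ray.nonnegVertex n := fun v =>
      LinearTree.eq_nonnegVertex v v.2
    refine ⟨r, h0, fun v => ?_, fun e => ?_, fun v => ?_⟩
    · obtain ⟨n, rfl⟩ := key v
      exact h1 n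
    · obtain ⟨n, rfl⟩ := key e
      exact h2 n
    · obtain ⟨n, rfl⟩ := key v
      intro y
      obtain ⟨k, y', h4, h5, s, hs, h6⟩ := h3 n y
      exact ⟨_, y', h4, h5, s, hs, by simpa [LinearTree.pos_nonnegVertex] using h6⟩
  | line =>
    obtain ⟨r', h0', h1', h2', h3'⟩ := h LinearTree.nonposVertex
      (fun n => LinearTree.nonposVertex (n + 1))
      (fun n => Or.inr ⟨(LinearTree.succ_nonposVertex n).symm, rfl⟩)
      (fun m n hmn => by
        have := congrArg LinearTree.Vertex.pos hmn
        simpa [LinearTree.pos_nonposVertex] using this) a b γ hγ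
    have hpos : ∀ x, 0 ≤ S.P x → (if 0 ≤ S.P x then r x else r' x) = r x := fun x hx => if_pos hx
    have hneg : ∀ x, S.P x ≤ 0 → (if 0 ≤ S.P x then r x else r' x) = r' x := by
      intro x hx
      split_ifs with hx'
      · have hx0 : S.P x = LinearTree.line.root.pos := by
          rw [LinearTree.pos_root]; exact le_antisymm hx hx'
        exact (h0 ⟨x, hx0⟩).trans (h0' ⟨x, hx0⟩).symm
      · rfl
    have ppos : ∀ n (y : S.VertexSpace (LinearTree.line.nonnegVertex n)), 0 ≤ S.P y.val := by
      intro n y; rw [S.P_val, LinearTree.pos_nonnegVertex]; positivity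
    have pneg : ∀ n (y : S.VertexSpace (LinearTree.nonposVertex n)), S.P y.val ≤ 0 := by
      intro n y; rw [S.P_val, LinearTree.pos_nonposVertex]; simp
    refine ⟨fun x => if 0 ≤ S.P x then r x else r' x, fun y => ?_, fun v y y' => ?_,
      fun e z => ?_, fun v y => ?_⟩
    · exact (hpos _ (ppos 0 y)).trans (h0 y)
    · rcases le_or_gt 0 v.pos with hv | hv
      · obtain ⟨n, rfl⟩ := LinearTree.eq_nonnegVertex v hv
        dsimp only
        rw [hpos _ (ppos n y), hpos _ (ppos n y')]
        exact h1 n y y'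
      · obtain ⟨n, rfl⟩ := LinearTree.eq_nonposVertex v hv
        dsimp only
        rw [hneg _ (pneg _ y), hneg _ (pneg _ y')]
        exact h1' _ y y'
    · have e0 : S.P (S.f e (z, 0)) = e.pos := by simp [S.P_f]
      have e1 : S.P (S.f e (z, 1)) = e.pos + 1 := by simp [S.P_f]
      dsimp only
      rcases le_or_gt 0 e.pos with hv | hv
      · rw [hpos _ (by rw [e0]; exact hv), hpos _ (by rw [e1]; linarith)]
        obtain ⟨n, rfl⟩ := LinearTree.eq_nonnegVertex e hv
        exact h2 n z
      · obtain ⟨n, rfl⟩ := LinearTree.eq_nonposVertex e hv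
        rw [hneg _ (by rw [e0]; exact hv.le),
          hneg _ (by rw [e1, LinearTree.pos_nonposVertex]; simp)]
        exact h2' n z
    · rcases le_or_gt 0 v.pos with hv | hv
      · obtain ⟨n, rfl⟩ := LinearTree.eq_nonnegVertex v hv
        obtain ⟨k, y', h4, h5, s, hs, h6⟩ := h3 n y
        exact ⟨_, y', (hpos _ (ppos n y)).trans h4, (hpos _ (ppos k y')).trans h5, s, hs,
          by simpa [LinearTree.pos_nonnegVertex] using h6⟩
      · obtain ⟨n, rfl⟩ := LinearTree.eq_nonposVertex v hv
        obtain ⟨k, y', h4, h5, s, hs, h6⟩ := h3' _ y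
        exact ⟨_, y', (hneg _ (pneg _ y)).trans h4, (hneg _ (pneg k y')).trans h5, s, hs,
          by simpa [LinearTree.pos_nonposVertex] using h6⟩

/-! ### The ladder as a coarse Lipschitz retract of the total space -/

theorem pathEDist_le_of_isGeodesicSegment {A : Set X} {γ : ℝ → X} {x y : X}
    (hγ : IsGeodesicSegment γ x y) {u v : ℝ} (hu : 0 ≤ u) (huv : u ≤ v) (hv : v ≤ dist x y)
    (hA : ∀ t ∈ Set.Icc u v, γ t ∈ A) : pathEDist A (γ u) (γ v) ≤ ENNReal.ofReal (v - u) := by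
  have hm : Set.MapsTo (fun τ => u + τ * (v - u)) (Set.Icc (0 : ℝ) 1) (Set.Icc u v) := by
    rintro τ ⟨h0, h1⟩
    constructor
    · have := mul_nonneg h0 (sub_nonneg.2 huv); dsimp only; linarith
    · have := mul_le_mul_of_nonneg_right h1 (sub_nonneg.2 huv); dsimp only; linarith
  have hsub : Set.Icc u v ⊆ Set.Icc 0 (dist x y) := Set.Icc_subset_Icc hu hv
  have hlip : LipschitzOnWith 1 γ (Set.Icc u v) := LipschitzOnWith.of_dist_le_mul
    fun s hs t ht => by rw [hγ.dist_eq s (hsub hs) t (hsub ht), Real.dist_eq]; simp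
  have hmono : MonotoneOn (fun τ : ℝ => u + τ * (v - u)) (Set.Icc 0 1) := fun s _ t _ hst => by
    have := mul_le_mul_of_nonneg_right hst (sub_nonneg.2 huv); dsimp only; linarith
  refine (iInf₂_le (γ ∘ fun τ => u + τ * (v - u)) ⟨hlip.continuousOn.comp (by fun_prop) hm,
    fun τ hτ => hA _ (hm hτ), by simp, by simp⟩).trans ?_
  refine (hlip.comp_eVariationOn_le hm).trans ?_
  have := (hmono.eVariationOn_eq (a := 0) (b := 1) (by simp) (by simp)).le
  simpa using this

/-- A geodesic that crosses the part `[e + s, e + t]` of an edge has length at least `t - s`. -/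
theorem sub_le_dist_of_crossing (hX : IsGeodesicMetricSpace X) (e : T.Vertex) {s t : ℝ}
    (hs : 0 < s) (hst : s ≤ t) (ht : t < 1) {x y : X} (hx : S.P x ≤ e.pos + s)
    (hy : e.pos + t ≤ S.P y) : t - s ≤ dist x y := by
  obtain ⟨γ, hγ⟩ := exists_isGeodesicSegment hX x y
  have hcont : ContinuousOn (fun r => S.P (γ r)) (Set.Icc 0 (dist x y)) :=
    S.continuous_P.comp_continuousOn hγ.continuousOn
  -- the last time at which the geodesic meets the fibre over `e + s`
  obtain ⟨u, ⟨hu, hus⟩, humax⟩ := (isCompact_Icc.of_isClosed_subset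
    (hcont.preimage_isClosed_of_isClosed isClosed_Icc (isClosed_Iic (a := e.pos + s)))
    Set.inter_subset_left).exists_isGreatest ⟨0, ⟨le_rfl, dist_nonneg⟩, by simpa [hγ.source]⟩
  have hPu : S.P (γ u) = e.pos + s := by
    have hc : ContinuousOn (fun r => S.P (γ r)) (Set.Icc u (dist x y)) :=
      hcont.mono (Set.Icc_subset_Icc hu.1 le_rfl)
    obtain ⟨w, hw, hw'⟩ := intermediate_value_Icc hu.2 hc
      (show e.pos + s ∈ _ from ⟨hus, by simp only [hγ.target]; linarith⟩)
    have : w ≤ u := humax ⟨⟨hu.1.trans hw.1, hw.2⟩, hw'.le⟩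
    rwa [← le_antisymm this hw.1]
  have hc : ContinuousOn (fun r => S.P (γ r)) (Set.Icc u (dist x y)) :=
    hcont.mono (Set.Icc_subset_Icc hu.1 le_rfl)
  -- the first time after `u` at which it meets the fibre over `e + t`
  obtain ⟨v, ⟨hv, hvt⟩, hvmin⟩ := (isCompact_Icc.of_isClosed_subset
    (hc.preimage_isClosed_of_isClosed isClosed_Icc (isClosed_Ici (a := e.pos + t)))
    Set.inter_subset_left).exists_isLeast ⟨dist x y, ⟨hu.2, le_rfl⟩, by simpa [hγ.target]⟩
  have hPv : S.P (γ v) = e.pos + t := by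
    obtain ⟨w, hw, hw'⟩ := intermediate_value_Icc hv.1 (hc.mono (Set.Icc_subset_Icc le_rfl hv.2))
      (show e.pos + t ∈ _ from ⟨by simp only [hPu]; linarith, hvt⟩)
    have : v ≤ w := hvmin ⟨⟨hw.1, hw.2.trans hv.2⟩, hw'.ge⟩
    rwa [← le_antisymm hw.2 this]
  have hmem : ∀ r ∈ Set.Icc u v, γ r ∈ S.P ⁻¹' Set.Ioo e.pos (e.pos + 1) := by
    intro r hr
    have h1 : e.pos + s ≤ S.P (γ r) := by
      by_contra! hlt
      have : r ≤ u := humax ⟨⟨hu.1.trans hr.1, hr.2.trans hv.2⟩, hlt.le⟩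
      rw [le_antisymm this hr.1, hPu] at hlt
      exact lt_irrefl _ hlt
    have h2 : S.P (γ r) ≤ e.pos + t := by
      by_contra! hlt
      have : v ≤ r := hvmin ⟨⟨hr.1, hr.2.trans hv.2⟩, hlt.le⟩
      rw [le_antisymm hr.2 this, hPv] at hlt
      exact lt_irrefl _ hlt
    exact ⟨by linarith, by linarith⟩
  have hlen := pathEDist_le_of_isGeodesicSegment hγ hu.1 hv.1 hv.2 hmem
  obtain ⟨⟨z, σ⟩, ⟨-, hσ⟩, hz⟩ := S.f_surjOn e (hmem u ⟨le_rfl, hv.1⟩)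
  obtain ⟨⟨z', τ⟩, ⟨-, hτ⟩, hz'⟩ := S.f_surjOn e (hmem v ⟨hv.1, le_rfl⟩)
  have hσs : (σ : ℝ) = s := by
    have := S.P_f e z σ; rw [hz, hPu] at this; linarith
  have hτt : (τ : ℝ) = t := by
    have := S.P_f e z' τ; rw [hz', hPv] at this; linarith
  rw [← hz, ← hz', S.f_isometry e z z' σ hσ τ hτ,
    ENNReal.ofReal_le_ofReal_iff (sub_nonneg.2 hv.1)] at hlen
  have h3 : t - s ≤ Real.sqrt (dist z z' ^ 2 + dist σ τ ^ 2) := by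
    refine Real.le_sqrt_of_sq_le ?_
    rw [Subtype.dist_eq, Real.dist_eq, hσs, hτt, sq_abs]
    nlinarith [sq_nonneg (dist z z')]
  linarith [hu.1, hv.2]

theorem exists_floor_vertex (x : X) : ∃ v : T.Vertex, v.pos ≤ S.P x ∧ S.P x < v.pos + 1 := by
  have hx : S.P x ∈ T.carrier := S.range_P ▸ ⟨x, rfl⟩
  have hv : (⌊S.P x⌋ : ℝ) ∈ T.carrier := by
    cases T
    · have hx : 0 ≤ S.P x := hx
      change (0 : ℝ) ≤ (⌊S.P x⌋ : ℝ)
      exact_mod_cast Int.floor_nonneg.2 hx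
    · trivial
  exact ⟨⟨_, hv⟩, Int.floor_le _, Int.lt_floor_add_one _⟩

theorem abs_P_sub_lt_one (hX : IsGeodesicMetricSpace X) {x y : X} (h : dist x y ≤ 1 / 4) :
    |S.P x - S.P y| < 1 := by
  have key : ∀ x y : X, dist x y ≤ 1 / 4 → S.P y < S.P x + 1 := by
    intro x y h
    by_contra! hlt
    obtain ⟨v, h1, h2⟩ := S.exists_floor_vertex x
    -- one of the intervals `[v + 5/8, v + 15/16]` and `[v + 17/16, v + 23/16]` is crossed
    rcases le_total (S.P x) (v.pos + 1 / 2) with h3 | h3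
    · have := S.sub_le_dist_of_crossing hX v (s := 5 / 8) (t := 15 / 16) (by norm_num) (by norm_num)
        (by norm_num) (by linarith : S.P x ≤ _) (by linarith : _ ≤ S.P y)
      linarith
    · have := S.sub_le_dist_of_crossing hX v.succ (s := 1 / 16) (t := 7 / 16) (by norm_num)
        (by norm_num) (by norm_num) (by rw [v.pos_succ]; linarith : S.P x ≤ _)
        (by rw [v.pos_succ]; linarith : _ ≤ S.P y)
      linarith
  rw [abs_lt]
  constructor <;> linarith [key x y h, key y x (by rwa [dist_comm])]

theorem abs_P_sub_le (hX : IsGeodesicMetricSpace X) (x y : X) :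
    |S.P x - S.P y| ≤ 4 * dist x y + 1 := by
  have key : ∀ (n : ℕ) (x y : X), dist x y ≤ n / 4 → |S.P x - S.P y| ≤ n := by
    intro n
    induction n with
    | zero =>
      intro x y h
      have : x = y := dist_le_zero.1 (by simpa using h)
      simp [this]
    | succ n ih =>
      intro x y h
      rcases le_total (dist x y) (1 / 4) with h1 | h1
      · have := S.abs_P_sub_lt_one hX h1
        push_cast
        have : (0 : ℝ) ≤ n := Nat.cast_nonneg n
        linarith
      · obtain ⟨γ, hγ⟩ := exists_isGeodesicSegment hX x y
        have ht : dist x y - 1 / 4 ∈ Set.Icc 0 (dist x y) := ⟨by linarith, by linarith⟩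
        have h2 := hγ.dist_source ht
        have h3 := hγ.dist_target ht
        push_cast at h ⊢
        have h4 := ih x (γ (dist x y - 1 / 4)) (by linarith)
        have h5 := S.abs_P_sub_lt_one hX (x := γ (dist x y - 1 / 4)) (y := y) (by linarith)
        have h6 := abs_sub_le (S.P x) (S.P (γ (dist x y - 1 / 4))) (S.P y)
        linarith
  have h1 := Nat.ceil_lt_add_one (by positivity : 0 ≤ 4 * dist x y)
  have h2 := Nat.le_ceil (4 * dist x y)
  exact (key ⌈4 * dist x y⌉₊ x y (by linarith)).trans h1.le

/-- Every point is moved to a vertex space by pushing it to the initial vertex of its edge. -/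
theorem exists_vertex_approximation (x : X) : ∃ (v : T.Vertex) (y : S.VertexSpace v),
    S.P x < v.pos + 1 ∧ dist x y.val ≤ 1 ∧ (x = y.val ∨ (v.pos < S.P x ∧
      ∃ (z : S.EdgeSpace v) (t : unitInterval), x = S.f v (z, t) ∧ y.val = S.f v (z, 0))) := by
  obtain ⟨v, h1, h2⟩ := S.exists_floor_vertex x
  rcases h1.eq_or_lt with h1 | h1
  · exact ⟨v, ⟨x, h1.symm⟩, h2, by simp, Or.inl rfl⟩
  · obtain ⟨⟨z, t⟩, -, rfl⟩ := S.f_surjOn v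
      (show x ∈ S.P ⁻¹' Set.Ioo v.pos (v.pos + 1) from ⟨h1, h2⟩)
    exact ⟨v, ⟨S.f v (z, 0), by simp [S.P_f]⟩, h2, S.dist_f_le_one _ _ _ _,
      Or.inr ⟨h1, z, t, rfl, rfl⟩⟩

theorem pos_eq_add_one {v w : T.Vertex} (h1 : v.pos < w.pos) (h2 : w.pos < v.pos + 2) :
    w = v.succ := by
  refine LinearTree.Vertex.pos_injective ?_
  rw [v.pos_succ]
  simp only [LinearTree.Vertex.pos] at *
  have h1 : v.1 < w.1 := by exact_mod_cast h1
  have h2 : w.1 < v.1 + 2 := by exact_mod_cast h2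
  exact_mod_cast (by omega : w.1 = v.1 + 1)

/-- A map that is defined on the vertex spaces, does not increase distances there, and is compatible
with the edges, extends to a coarse Lipschitz map of the total space. -/
theorem exists_coarse_extension (hX : IsGeodesicMetricSpace X) (C : ℝ) : ∃ D : ℝ, ∀ ρ : X → X,
    (∀ v (y y' : S.VertexSpace v), dist (ρ y.val) (ρ y'.val) ≤ dist y y') →
    (∀ e (z : S.EdgeSpace e), dist (ρ (S.f e (z, 0))) (ρ (S.f e (z, 1))) ≤ C) →
    ∃ r : X → X, (∀ v (y : S.VertexSpace v), r y.val = ρ y.val) ∧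
      (∀ x, ∃ v, ∃ y : S.VertexSpace v, r x = ρ y.val) ∧
      ∀ x x', dist x x' ≤ 1 / 4 → dist (r x) (r x') ≤ D := by
  obtain ⟨N, hN, hprop⟩ := S.uniformly_proper (9 / 4) (by norm_num)
  refine ⟨N + |C|, fun ρ h1 h2 => ?_⟩
  have hex : ∀ x : X, ∃ (p : X) (v : T.Vertex) (y : S.VertexSpace v), p = y.val ∧
      S.P x < v.pos + 1 ∧ dist x y.val ≤ 1 ∧ (x = y.val ∨ (v.pos < S.P x ∧
      ∃ (z : S.EdgeSpace v) (t : unitInterval), x = S.f v (z, t) ∧ y.val = S.f v (z, 0))) := by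
    intro x
    obtain ⟨v, y, h⟩ := S.exists_vertex_approximation x
    exact ⟨_, v, y, rfl, h⟩
  choose p hp using hex
  have hρ : ∀ v (y y' : S.VertexSpace v), dist y.val y'.val ≤ 9 / 4 →
      dist (ρ y.val) (ρ y'.val) ≤ N := fun v y y' h => (h1 v y y').trans (hprop v y y' h)
  have hC := abs_nonneg C
  have le_of : ∀ {v : T.Vertex} {y : S.VertexSpace v} {x : X}, (x = y.val ∨ (v.pos < S.P x ∧
      ∃ (z : S.EdgeSpace v) (t : unitInterval), x = S.f v (z, t) ∧ y.val = S.f v (z, 0))) →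
      v.pos ≤ S.P x := by
    rintro v y x (rfl | h)
    · exact (S.P_val y).ge
    · exact h.1.le
  refine ⟨fun x => ρ (p x), fun w y' => ?_, fun x => ?_, ?_⟩
  · obtain ⟨v, y, hpy, hlt, -, h⟩ := hp y'.val
    rcases h with h | ⟨h, -⟩
    · exact congrArg ρ (hpy.trans h.symm)
    · rw [S.P_val] at h hlt
      have := pos_eq_add_one h (by linarith)
      rw [this, v.pos_succ] at hlt
      exact absurd hlt (lt_irrefl _)
  · obtain ⟨v, y, hpy, -⟩ := hp x
    exact ⟨v, y, by simp only [hpy]⟩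
  · -- by symmetry the first point may be assumed to lie over the lower edge
    have key : ∀ x x' (v v' : T.Vertex) (y : S.VertexSpace v) (y' : S.VertexSpace v'),
        S.P x < v.pos + 1 → dist x y.val ≤ 1 → (x = y.val ∨ (v.pos < S.P x ∧
        ∃ (z : S.EdgeSpace v) (t : unitInterval), x = S.f v (z, t) ∧ y.val = S.f v (z, 0))) →
        dist x' y'.val ≤ 1 → v'.pos ≤ S.P x' → v.pos ≤ v'.pos → dist x x' ≤ 1 / 4 →
        dist (ρ y.val) (ρ y'.val) ≤ N + |C| := by
      intro x x' v v' y y' ha hb hc hb' hc' hvv hd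
      have hP := abs_lt.1 (S.abs_P_sub_lt_one hX hd)
      rcases hvv.eq_or_lt with hvv | hvv
      · obtain rfl := LinearTree.Vertex.pos_injective hvv
        have := hρ v y y' (by
          have := dist_triangle4 y.val x x' y'.val
          rw [dist_comm y.val x] at this
          linarith)
        linarith
      · obtain rfl := pos_eq_add_one hvv (by linarith)
        rw [v.pos_succ] at hc'
        rcases hc with rfl | ⟨-, z, t, rfl, hy⟩
        · rw [S.P_val] at hP; linarith
        · have e1 := h2 v z
          rw [← hy] at e1
          have e2 := hρ v.succ ⟨S.f v (z, 1), by simp [S.P_f, v.pos_succ]⟩ y' (by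
            have := dist_triangle4 (S.f v (z, 1)) (S.f v (z, t)) x' y'.val
            have := S.dist_f_le_one v z 1 t
            dsimp only
            linarith)
          have e3 := dist_triangle (ρ y.val) (ρ (S.f v (z, 1))) (ρ y'.val)
          have e4 := le_abs_self C
          dsimp only at e2
          linarith
    intro x x' hd
    obtain ⟨v, y, hpy, ha, hb, hc⟩ := hp x
    obtain ⟨v', y', hpy', ha', hb', hc'⟩ := hp x'
    simp only [hpy, hpy']
    rcases le_total v.pos v'.pos with hvv | hvv
    · exact key x x' v v' y y' ha hb hc hb' (le_of hc') hvv hd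
    · rw [dist_comm]
      exact key x' x v' v y' y ha' hb' hc' hb (le_of hc) hvv (by rwa [dist_comm])

/-- The fixed point set of a coarse Lipschitz retraction of a geodesic space is coarsely path
convex. -/
theorem isChainConvex_of_retraction (hX : IsGeodesicMetricSpace X) {D : ℝ} {r : X → X} {B : Set X}
    (hr : ∀ x x', dist x x' ≤ 1 / 4 → dist (r x) (r x') ≤ D) (hB : ∀ x, r x ∈ B)
    (hfix : ∀ x ∈ B, r x = x) : IsChainConvex (max D 4) B := by
  intro p hp q hq
  obtain ⟨γ, hγ⟩ := exists_isGeodesicSegment hX p q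
  have hm : ∀ i : ℕ, min ((i : ℝ) / 4) (dist p q) ∈ Set.Icc 0 (dist p q) := fun i =>
    ⟨le_min (by positivity) dist_nonneg, min_le_right _ _⟩
  have h1 := Nat.le_ceil (4 * dist p q)
  have h2 := (Nat.ceil_lt_add_one (by positivity : 0 ≤ 4 * dist p q)).le
  refine ⟨⌈4 * dist p q⌉₊, fun i => r (γ (min (i / 4) (dist p q))), ?_, ?_, ?_, fun i => hB _, ?_⟩
  · simp [hγ.source, hfix p hp]
  · dsimp only
    rw [min_eq_right (by linarith), hγ.target, hfix q hq]
  · have h3 := le_max_right D 4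
    have h4 := mul_le_mul_of_nonneg_right h3 (dist_nonneg (x := p) (y := q))
    linarith
  · intro i _
    refine (hr _ _ ?_).trans (le_max_left _ _)
    rw [hγ.dist_eq _ (hm _) _ (hm _)]
    refine (abs_min_sub_min_le_max _ _ _ _).trans ?_
    push_cast
    rw [sub_self, abs_zero, abs_sub_comm, show ((i : ℝ) + 1) / 4 - i / 4 = 1 / 4 by ring]
    norm_num

/-- If the geodesics of `Y₀` between `a` and `b` are far from the base point, then so are the
geodesics of `X`: the ladder of the former is far from the base point, and the latter stay near the
ladder. -/
theorem exists_gromovProduct_bound {δ : ℝ} (hX : IsDeltaHyperbolic δ X)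
    (y₀ : S.VertexSpace T.root) (x₀ : X) (M : ℝ) : ∃ N : ℝ, ∀ a b : S.VertexSpace T.root,
    N ≤ gromovProduct y₀ a b → M ≤ gromovProduct x₀ a.val b.val := by
  obtain ⟨C, hC, hret⟩ := S.exists_vertex_retraction
  obtain ⟨D, hext⟩ := S.exists_coarse_extension hX.geodesic C
  obtain ⟨R, hR, hstab⟩ := exists_dist_le_of_isChainConvex δ (max D 4)
  set d := M + R + 2 * δ + dist x₀ y₀.val with hd
  obtain ⟨N, hN, hprop⟩ := S.uniformly_proper (max 1 (d * (1 + 4 * C) + C)) (by positivity)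
  refine ⟨N + 1, fun a b hab => ?_⟩
  obtain ⟨γ, hγ⟩ := exists_isGeodesicSegment (S.vertex_hyperbolic T.root).geodesic a b
  obtain ⟨ρ, h0, h1, h2, h3⟩ := hret a b γ hγ
  obtain ⟨r, hr1, hr2, hr3⟩ := hext ρ h1 h2
  set B : Set X := {x | r x = x ∧ ∃ s ∈ Set.Icc 0 (dist a b), dist x (γ s).val ≤ C * |S.P x|}
  have hrB : ∀ x, r x ∈ B := by
    intro x
    obtain ⟨v, y, hy⟩ := hr2 x
    obtain ⟨w, y', h4, h5, s, hs, h6⟩ := h3 v y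
    rw [hy, h4]
    exact ⟨(hr1 w y').trans h5, s, hs, by rwa [S.P_val]⟩
  have hB := isChainConvex_of_retraction hX.geodesic hr3 hrB fun x hx => hx.1
  have mem_of : ∀ y : S.VertexSpace T.root, ρ y.val = y.val → y.val ∈ B := fun y hy => by
    have := hrB y.val
    rwa [hr1 _ y, hy] at this
  have haB : a.val ∈ B := mem_of a (by
    rw [h0, show gromovProduct a a b = 0 by simp [gromovProduct, dist_comm b a], hγ.source])
  have hbB : b.val ∈ B := mem_of b (by rw [h0, gromovProduct_self, dist_comm b a, hγ.target])
  have hfar : ∀ x ∈ B, d < dist x y₀.val := by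
    rintro x ⟨-, s, hs, hxs⟩
    have e1 := hγ.gromovProduct_le_dist_apply hs y₀
    have e2 : max 1 (d * (1 + 4 * C) + C) < dist y₀.val (γ s).val := by
      by_contra! hle
      have := hprop T.root y₀ (γ s) hle
      linarith
    have e3 := (le_max_right _ _).trans_lt e2
    have e4 := dist_triangle y₀.val x (γ s).val
    have e5 := S.abs_P_sub_le hX.geodesic x y₀.val
    rw [show S.P y₀.val = 0 from (S.P_val y₀).trans T.pos_root, sub_zero] at e5
    have e6 := mul_le_mul_of_nonneg_left e5 hC
    rw [dist_comm y₀.val x] at e4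
    by_contra! hle
    have e7 : dist x y₀.val * (1 + 4 * C) ≤ d * (1 + 4 * C) := by gcongr
    linarith
  obtain ⟨η, hη⟩ := exists_isGeodesicSegment hX.geodesic a.val b.val
  obtain ⟨x, hx, hxd⟩ := hstab hX hB haB hbB hη _ (gromovProduct_mem_Icc a.val y₀.val b.val)
  have f1 := hfar x hx
  have f2 := hX.dist_projection_le hη y₀.val
  have f3 := dist_triangle y₀.val (η (gromovProduct a.val y₀.val b.val)) x
  have f4 := gromovProduct_le_add_base y₀.val x₀ a.val b.val
  rw [dist_comm x] at f1
  rw [dist_comm y₀.val x₀] at f4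
  linarith

end TreeOfHyperbolicSpaces

namespace CannonThurston

open scoped Topology
open Filter

/-! ### Extension to the Gromov compactifications -/

section Boundary

variable {X : Type*} [MetricSpace X] {x₀ : X}

theorem GeodesicRay.gromovProduct_eq (r : GeodesicRay X x₀) (s t : ℝ≥0) :
    gromovProduct x₀ (r.1 s) (r.1 t) = min s t := by
  have h : ∀ u, dist (r.1 u) x₀ = u := fun u => by
    have h0 := r.2.1.dist_eq u 0
    rw [r.2.2] at h0
    rw [h0, NNReal.dist_eq]; simp
  rw [gromovProduct, h, h, r.2.1.dist_eq, NNReal.dist_eq]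
  rcases le_total s t with hst | hst
  · have hst' : (s : ℝ) ≤ t := hst
    rw [abs_of_nonpos (by linarith), min_eq_left hst]; ring
  · have hst' : (t : ℝ) ≤ s := hst
    rw [abs_of_nonneg (by linarith), min_eq_right hst]; ring

/-- A sequence whose Gromov products tend to infinity converges to the endpoint of a geodesic ray.
The ray is a limit along an ultrafilter of the geodesics from the base point to the members of the
sequence; the limit exists as the space is proper. -/
theorem exists_limit_ray [ProperSpace X] {δ : ℝ} (hX : IsDeltaHyperbolic δ X) (x : ℕ → X)
    (hx : ∀ M : ℝ, ∃ N, ∀ m n, N ≤ m → N ≤ n → M ≤ gromovProduct x₀ (x m) (x n)) :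
    ∃ r : GeodesicRay X x₀, ∀ M : ℝ, ∃ N : ℕ, ∀ n ≥ N, ∀ᶠ t in atTop,
      M ≤ gromovProduct x₀ (x n) (r.1 t) := by
  choose γ hγ using fun n => exists_isGeodesicSegment hX.geodesic x₀ (x n)
  have hd : ∀ M : ℝ, ∀ᶠ n in hyperfilter ℕ, M ≤ dist x₀ (x n) := by
    intro M
    obtain ⟨N, hN⟩ := hx M
    refine Nat.hyperfilter_le_atTop (eventually_atTop.2 ⟨N, fun n hn => ?_⟩)
    simpa [gromovProduct_self, dist_comm] using hN n n hn hn
  have hm : ∀ n (t : ℝ≥0), min (t : ℝ) (dist x₀ (x n)) ∈ Set.Icc 0 (dist x₀ (x n)) := fun n t =>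
    ⟨le_min t.2 dist_nonneg, min_le_right _ _⟩
  have hlim : ∀ t : ℝ≥0, ∃ p, Tendsto (fun n => γ n (min (t : ℝ) (dist x₀ (x n))))
      (hyperfilter ℕ) (𝓝 p) := by
    intro t
    have hball : ∀ n, γ n (min (t : ℝ) (dist x₀ (x n))) ∈ Metric.closedBall x₀ t := fun n => by
      rw [Metric.mem_closedBall, dist_comm, (hγ n).dist_source (hm n t)]
      exact min_le_left _ _
    obtain ⟨p, -, hp⟩ := (isCompact_closedBall x₀ (t : ℝ)).ultrafilter_le_nhds
      ((hyperfilter ℕ).map fun n => γ n (min (t : ℝ) (dist x₀ (x n))))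
      (le_principal_iff.2 (Ultrafilter.mem_map.2 (Filter.Eventually.of_forall hball)))
    exact ⟨p, hp⟩
  choose r hr using hlim
  have hiso : Isometry r := by
    refine Isometry.of_dist_eq fun s t => ?_
    refine tendsto_nhds_unique ((hr s).dist (hr t)) (tendsto_const_nhds.congr' ?_)
    filter_upwards [hd s, hd t] with n hs ht
    rw [(hγ n).dist_eq _ (hm n s) _ (hm n t), min_eq_left hs, min_eq_left ht, NNReal.dist_eq]
  have hr0 : r 0 = x₀ := by
    refine tendsto_nhds_unique (hr 0) (tendsto_const_nhds.congr fun n => ?_)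
    simp [(hγ n).source]
  refine ⟨⟨r, hiso, hr0⟩, fun M => ?_⟩
  obtain ⟨N, hN⟩ := hx (M + 1 + δ)
  refine ⟨N, fun n hn => ?_⟩
  filter_upwards [eventually_ge_atTop (M + 1 + δ).toNNReal] with t ht
  have ht' : M + 1 + δ ≤ t := Real.toNNReal_le_iff_le_coe.1 ht
  -- a geodesic of the sequence that is close to the limit ray at time `t`
  obtain ⟨k, hk1, hk2, hk3⟩ := ((hd t).and (((hr t).eventually (Metric.ball_mem_nhds _ one_pos)).and
    (Nat.hyperfilter_le_atTop (eventually_ge_atTop N)))).exists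
  rw [min_eq_left hk1] at hk2
  have e1 : gromovProduct x₀ (x k) (γ k t) = t := by
    rw [gromovProduct_comm]; exact (hγ k).gromovProduct_apply ⟨t.2, hk1⟩
  have e2 := gromovProduct_le_add_right x₀ (x k) (γ k t) (r t)
  have e3 := hN n k hn hk3
  have e4 := hX.four_point x₀ (x n) (x k) (r t)
  have e5 : dist (γ k t) (r t) < 1 := hk2
  have e6 := le_min (e3.trans' (by linarith) : M + δ ≤ _)
    (by linarith : M + δ ≤ gromovProduct x₀ (x k) (r t))
  change M ≤ gromovProduct x₀ (x n) (r t)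
  linarith

/-- Replacing a ray by an equivalent one lowers the eventual Gromov products with it by at most `δ`,
whatever the distance between the two rays. -/
theorem le_gromovProduct_of_equiv {δ : ℝ} (hX : IsDeltaHyperbolic δ X) {r r' : GeodesicRay X x₀}
    (h : r ≈ r') {p : ℝ≥0 → X} {m : ℝ} (hp : ∀ᶠ t in atTop, m ≤ gromovProduct x₀ (p t) (r.1 t)) :
    ∀ᶠ t in atTop, m - δ ≤ gromovProduct x₀ (p t) (r'.1 t) := by
  obtain ⟨D, hD⟩ := h
  filter_upwards [hp, eventually_ge_atTop (m + D).toNNReal] with t h1 h2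
  have h2' : m + D ≤ t := Real.toNNReal_le_iff_le_coe.1 h2
  have e1 := GeodesicRay.gromovProduct_eq r t t
  rw [min_self] at e1
  have e2 := gromovProduct_le_add_right x₀ (r.1 t) (r.1 t) (r'.1 t)
  have e3 := hD t
  have e4 := hX.four_point x₀ (p t) (r.1 t) (r'.1 t)
  have e5 := le_min h1 (by linarith : m ≤ gromovProduct x₀ (r.1 t) (r'.1 t))
  linarith

end Boundary

/-- If large Gromov products in `Y` have large Gromov products in `X` as images, then `i` extends
continuously to the Gromov compactifications. -/
theorem hasCannonThurstonMap_of_gromovProduct {X Y : Type*} [MetricSpace X] [ProperSpace X]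
    [MetricSpace Y] {δ δ' : ℝ} (hX : IsDeltaHyperbolic δ X) (hY : IsDeltaHyperbolic δ' Y)
    {i : Y → X} (hi : Continuous i) (y₀ : Y) (x₀ : X)
    (h : ∀ M : ℝ, ∃ N : ℝ, ∀ a b, N ≤ gromovProduct y₀ a b → M ≤ gromovProduct x₀ (i a) (i b)) :
    HasCannonThurstonMap i y₀ x₀ := by
  -- images of rays have limit rays
  have hlim : ∀ q : GeodesicRay Y y₀, ∃ s : GeodesicRay X x₀, ∀ M : ℝ, ∀ᶠ t in atTop,
      M ≤ gromovProduct x₀ (i (q.1 t)) (s.1 t) := by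
    intro q
    have large : ∀ M : ℝ, ∃ N : ℕ, ∀ t t' : ℝ≥0, (N : ℝ) ≤ t → (N : ℝ) ≤ t' →
        M ≤ gromovProduct x₀ (i (q.1 t)) (i (q.1 t')) := by
      intro M
      obtain ⟨N, hN⟩ := h M
      obtain ⟨N', hN'⟩ := exists_nat_ge N
      refine ⟨N', fun t t' ht ht' => hN _ _ ?_⟩
      rw [GeodesicRay.gromovProduct_eq, NNReal.coe_min]
      exact le_min (hN'.trans ht) (hN'.trans ht')
    obtain ⟨s, hs⟩ := exists_limit_ray (x₀ := x₀) hX (fun n : ℕ => i (q.1 n)) (fun M => by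
      obtain ⟨N, hN⟩ := large M
      exact ⟨N, fun m n hm hn => hN _ _ (by exact_mod_cast hm) (by exact_mod_cast hn)⟩)
    refine ⟨s, fun M => ?_⟩
    obtain ⟨N₁, hN₁⟩ := large (M + δ)
    obtain ⟨N₂, hN₂⟩ := hs (M + δ)
    filter_upwards [hN₂ (max N₁ N₂) (le_max_right _ _), eventually_ge_atTop (N₁ : ℝ≥0)]
      with t h1 h2
    have e1 := hN₁ t ((max N₁ N₂ : ℕ) : ℝ≥0) (by exact_mod_cast h2)
      (by exact_mod_cast le_max_left _ _)
    have e2 := hX.four_point x₀ (i (q.1 t)) (i (q.1 ((max N₁ N₂ : ℕ) : ℝ≥0))) (s.1 t)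
    have e3 := le_min e1 h1
    linarith
  choose L hL using hlim
  let out : GromovBoundary Y y₀ → GeodesicRay Y y₀ := Quotient.out
  have hout : ∀ q : GeodesicRay Y y₀, q ≈ out q.endpoint := fun q =>
    Setoid.symm (Quotient.mk_out q)
  let F : GromovCompactification Y y₀ → GromovCompactification X x₀ := fun z => match z with
    | .point y => .point (i y)
    | .bdry ξ => .bdry (L (out ξ)).endpoint
  refine ⟨F, ⟨fun U hU => ⟨hU.1.preimage hi, fun r hr => ?_⟩⟩, fun y => rfl⟩
  obtain ⟨n, hn⟩ := hU.2 _ hr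
  obtain ⟨N, hN⟩ := h (n + 2 * δ)
  have hδ := hX.delta_nonneg x₀
  refine ⟨N + 2 * δ', fun z hz => hn ?_⟩
  have hlr := hL (out r.endpoint)
  rcases hz with ⟨y, rfl, hy⟩ | ⟨q, rfl, hq⟩
  · refine Or.inl ⟨i y, rfl, ?_⟩
    have h1 := le_gromovProduct_of_equiv hY (hout r) (p := fun _ => y) hy
    have hδ' := hY.delta_nonneg y₀
    filter_upwards [h1, hlr (n + 2 * δ)] with t e1 e2
    have e3 := hN y _ (e1.trans' (by linarith))
    have e4 := hX.four_point x₀ (i y) (i ((out r.endpoint).1 t)) ((L (out r.endpoint)).1 t)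
    have e5 := le_min e3 e2
    linarith
  · refine Or.inr ⟨L (out q.endpoint), rfl, ?_⟩
    have h1 := le_gromovProduct_of_equiv hY (hout r) (p := q.1) hq
    simp only [gromovProduct_comm y₀ (q.1 _)] at h1
    have h2 := le_gromovProduct_of_equiv hY (hout q) h1
    filter_upwards [h2, hlr (n + 2 * δ), hL (out q.endpoint) (n + 2 * δ)] with t e1 e2 e3
    have e4 := hN _ _ (e1.trans' (by linarith))
    rw [gromovProduct_comm] at e4 e3
    have e5 := hX.four_point x₀ (i ((out q.endpoint).1 t)) (i ((out r.endpoint).1 t))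
      ((L (out r.endpoint)).1 t)
    have e6 := le_min e4 e2
    have e7 := hX.four_point x₀ ((L (out q.endpoint)).1 t) (i ((out q.endpoint).1 t))
      ((L (out r.endpoint)).1 t)
    have e8 := le_min (e3.trans' (by linarith) : n + δ ≤ _) (by linarith : n + δ ≤ gromovProduct x₀
      (i ((out q.endpoint).1 t)) ((L (out r.endpoint)).1 t))
    linarith

end CannonThurston

theorem theorem3p3 {X : Type*} [MetricSpace X] [ProperSpace X] (T : LinearTree)
    (S : TreeOfHyperbolicSpaces X T) (hX : IsHyperbolic X)
    (y₀ : S.VertexSpace T.root) (x₀ : X) :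
    HasCannonThurstonMap (S.inclusion T.root) y₀ x₀ := by
  obtain ⟨δ, hδ⟩ := hX
  have hi : LipschitzWith 1 (S.inclusion T.root) := LipschitzWith.of_dist_le_mul fun x y => by
    rw [NNReal.coe_one, one_mul]
    exact TreeOfHyperbolicSpaces.dist_val_le x y
  exact CannonThurston.hasCannonThurstonMap_of_gromovProduct hδ (S.vertex_hyperbolic T.root)
    hi.continuous y₀ x₀ (S.exists_gromovProduct_bound hδ y₀ x₀)
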